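/- Let $\mathbb I=[0,1]$ and $d\ge 2$. A $d$-dimensional copula $C:\mathbb I^d\to\mathbb I$ is the restriction to $\mathbb I^d$ of the distribution function of a random vector $(X_1,\dots,X_d)$ with each $X_i$ uniformly distributed on $\mathbb I$; $\mu_C$ denotes the Borel probability measure on $\mathbb I^d$ with $\mu_C([\mathbf 0,\mathbf x])=C(\mathbf x)$ for all $\mathbf x\in\mathbb I^d$. A generator is a continuous non-increasing function $\psi:[0,\infty)\to\mathbb I$ with $\psi(0)=1$ and $\lim_{z\to\infty}\psi(z)=0=:\psi(\infty)$ that is strictly decreasing on $[0,\inf\{x:\psi(x)=0\})$ (where $\inf\emptyset=\infty$); its pseudo-inverse is $\varphi(y)=\inf\{z\in[0,\infty]:\psi(z)=y\}$, $y\in\mathbb I$. A copula $C$ is Archimedean if $C(\mathbf x)=\psi\big(\sum_{i=1}^d\varphi(x_i)\big)$ for all $\mathbf x\in\mathbb I^d$, for some generator $\psi$. Let $\mathcal C_{ar}^d$ be the set of all $d$-dimensional Archimedean copulas, with the metric $d_\infty(A,B)=\sup_{\mathbf x\in\mathbb I^d}|A(\mathbf x)-B(\mathbf x)|$. For a copula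 $C$ let $\mu_{C^{1:d-1}}$ be the image of $\mu_C$ under the projection to the first $d-1$ coordinates and let $K_C(\mathbf x,\cdot)$, $\mathbf x\in\mathbb I^{d-1}$, be a regular conditional distribution, under $\mu_C$, of the last coordinate given the first $d-1$. Decompose $K_C(\mathbf x,\cdot)=K_C^{abs}(\mathbf x,\cdot)+K_C^{dis}(\mathbf x,\cdot)+K_C^{sing}(\mathbf x,\cdot)$ into its absolutely continuous part (with respect to Lebesgue measure on $\mathbb I$), its discrete part and its singular part without point masses, and for $\ast\in\{abs,dis,sing\}$ let $\mu_C^{\ast}$ be the measure on $\mathbb I^d$ determined by $\mu_C^{\ast}(E\times F)=\int_E K_C^{\ast}(\mathbf x,F)\,\mathrm d\mu_{C^{1:d-1}}(\mathbf x)$ for Borel sets $E\subseteq\mathbb I^{d-1}$, $F\subseteq\mathbb I$. A copula $C$ is called absolutely continuous, discrete or singular if $\mu_{C^{1:d-1}}$ is absolutely continuous with respect to $(d-1)$-dimensional Lebesgue measure and $\mu_C^{abs}(\mathbb I^d)=1$, $\mu_C^{dis}(\mathbb I^d)=1$ or $\mu_C^{sing}(\mathbb I^d)=1$, respectively. The support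 $\mathrm{supp}(\nu)$ of a finite measure $\nu$ on $\mathbb I^d$ is the complement of the union of all open $\nu$-null sets. Then each of the following four families is dense in $(\mathcal C_{ar}^d,d_\infty)$: 1. the absolutely continuous $C\in\mathcal C_{ar}^d$ with $\mathrm{supp}(\mu_C)=\mathbb I^d$; 2. the discrete $C\in\mathcal C_{ar}^d$ with $\mathrm{supp}(\mu_C)=\mathbb I^d$; 3. the singular $C\in\mathcal C_{ar}^d$ with $\mathrm{supp}(\mu_C)=\mathbb I^d$; 4. the $C\in\mathcal C_{ar}^d$ with $\mathrm{supp}(\mu_C^{abs})=\mathrm{supp}(\mu_C^{dis})=\mathrm{supp}(\mu_C^{sing})=\mathbb I^d$. -/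

import Mathlib

open MeasureTheory ProbabilityTheory Filter Topology
open scoped ENNReal NNReal

namespace Archimedean

/-- The unit cube `𝕀^d` with `𝕀 = [0,1]`; it carries the product topology, the product (Borel)
`σ`-field, the product order and, as `volume`, the `d`-dimensional Lebesgue measure. -/
abbrev Cube (d : ℕ) : Type := Fin d → unitInterval

/-! ### Copulas -/

/-- A `d`-dimensional copula: the restriction to `𝕀^d` of the distribution function of a random
vector (with law `μ`) all of whose coordinates are uniformly distributed on `𝕀`. -/
structure Copula (d : ℕ) where
  toFun : Cube d → ℝ
  exists_law : ∃ μ : Measure (Cube d), IsProbabilityMeasure μ ∧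
    (∀ i, μ.map (fun u => u i) = volume) ∧ ∀ x, toFun x = μ.real (Set.Iic x)

namespace Copula

variable {d : ℕ}

instance : CoeFun (Copula d) (fun _ => Cube d → ℝ) := ⟨toFun⟩

theorem ext_toFun {A B : Copula d} (h : ∀ x, A x = B x) : A = B := by
  cases A; cases B
  congr
  exact funext h

/-- The `d`-stochastic measure `μ_C` of the copula `C`: the probability measure on `𝕀^d` with
`μ_C([0,x]) = C(x)` (it is unique, see `Copula.eq_measure`). -/
noncomputable def measure (C : Copula d) : Measure (Cube d) := C.exists_law.choose

instance (C : Copula d) : IsProbabilityMeasure C.measure := C.exists_law.choose_spec.1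

theorem measure_map_eval (C : Copula d) (i : Fin d) :
    C.measure.map (fun u => u i) = volume := C.exists_law.choose_spec.2.1 i

theorem apply_eq (C : Copula d) (x : Cube d) : C x = C.measure.real (Set.Iic x) :=
  C.exists_law.choose_spec.2.2 x

theorem apply_nonneg (C : Copula d) (x : Cube d) : 0 ≤ C x := by
  rw [C.apply_eq]; exact measureReal_nonneg

theorem apply_le_one (C : Copula d) (x : Cube d) : C x ≤ 1 := by
  rw [C.apply_eq]; exact measureReal_le_one

/-- `μ_C` is determined by `C`. -/
theorem eq_measure (C : Copula d) (μ : Measure (Cube d)) [IsProbabilityMeasure μ]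
    (h : ∀ x, C x = μ.real (Set.Iic x)) : μ = C.measure := by
  have hgen : (MeasurableSpace.pi : MeasurableSpace (Cube d)) =
      MeasurableSpace.generateFrom
        (Set.pi Set.univ '' Set.pi Set.univ fun _ : Fin d => Set.range (Set.Iic (α := unitInterval))) := by
    refine (generateFrom_eq_pi (C := fun _ : Fin d => Set.range (Set.Iic (α := unitInterval)))
      (fun i => ?_) (fun i => ?_)).symm
    · rw [← borel_eq_generateFrom_Iic]; exact (BorelSpace.measurable_eq).symm
    · exact ⟨fun _ => Set.univ, fun _ => ⟨1, by ext x; simpa using unitInterval.le_one'⟩, Set.iUnion_const _⟩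
  refine ext_of_generate_finite _ hgen (IsPiSystem.pi fun _ => ?_) ?_ (by simp)
  · rintro _ ⟨a, rfl⟩ _ ⟨b, rfl⟩ -
    exact ⟨a ⊓ b, by simp [Set.Iic_inter_Iic]⟩
  · rintro _ ⟨s, hs, rfl⟩
    choose x hx using fun i => hs i (Set.mem_univ i)
    have hsx : Set.pi Set.univ s = Set.Iic x := by
      rw [← Set.pi_univ_Iic]; congr; funext i; exact (hx i).symm
    rw [hsx]
    have := (h x).symm.trans (C.apply_eq x)
    rwa [Measure.real, Measure.real,
      ENNReal.toReal_eq_toReal_iff' (measure_ne_top _ _) (measure_ne_top _ _)] at this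

/-- The uniform metric `d_∞(A, B) = sup_x |A(x) - B(x)|`. -/
noncomputable instance : Dist (Copula d) := ⟨fun A B => ⨆ x, |A x - B x|⟩

theorem dist_def (A B : Copula d) : dist A B = ⨆ x, |A x - B x| := rfl

theorem bddAbove_abs_sub (A B : Copula d) : BddAbove (Set.range fun x => |A x - B x|) := by
  refine ⟨1, ?_⟩
  rintro _ ⟨x, rfl⟩
  rw [abs_le]
  constructor <;>
    linarith [A.apply_nonneg x, A.apply_le_one x, B.apply_nonneg x, B.apply_le_one x]

theorem abs_sub_le_dist (A B : Copula d) (x : Cube d) : |A x - B x| ≤ dist A B :=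
  le_ciSup (bddAbove_abs_sub A B) x

noncomputable instance : MetricSpace (Copula d) where
  dist_self A := by simp [dist_def]
  dist_comm A B := by simp [dist_def, abs_sub_comm]
  dist_triangle A B D := ciSup_le fun x =>
    (abs_sub_le _ (B x) _).trans (add_le_add (abs_sub_le_dist A B x) (abs_sub_le_dist B D x))
  eq_of_dist_eq_zero {A B} h := ext_toFun fun x => by
    have := abs_sub_le_dist A B x
    rw [h] at this
    exact sub_eq_zero.1 (abs_nonpos_iff.1 this)

end Copula

/-! ### Archimedean generators and Archimedean copulas -/

/-- An Archimedean generator `ψ : [0,∞) → 𝕀`: continuous, non-increasing, `ψ(0) = 1`,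
`ψ(z) → 0` as `z → ∞`, strictly decreasing on `[0, inf {x | ψ(x) = 0})` with `inf ∅ = ∞`. -/
structure IsGenerator (ψ : ℝ≥0 → unitInterval) : Prop where
  antitone : Antitone ψ
  continuous : Continuous ψ
  map_zero : ψ 0 = 1
  tendsto_atTop : Tendsto ψ atTop (𝓝 0)
  strictAntiOn : StrictAntiOn ψ
    {z | (z : ℝ≥0∞) < sInf ((fun x : ℝ≥0 => (x : ℝ≥0∞)) '' {x | ψ x = 0})}

/-- The extension of `ψ` to `[0,∞]` by `ψ(∞) = 0`. -/
noncomputable def extendTop (ψ : ℝ≥0 → unitInterval) (z : ℝ≥0∞) : unitInterval :=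
  if z = ∞ then 0 else ψ z.toNNReal

/-- The pseudo-inverse `φ(y) = inf {z ∈ [0,∞] | ψ(z) = y}` of a generator `ψ`. -/
noncomputable def pseudoInverse (ψ : ℝ≥0 → unitInterval) (y : unitInterval) : ℝ≥0∞ :=
  sInf {z | extendTop ψ z = y}

/-- `C` is Archimedean if `C(x) = ψ(φ(x₁) + ⋯ + φ(x_d))` for some Archimedean generator `ψ`. -/
def Copula.IsArchimedean {d : ℕ} (C : Copula d) : Prop :=
  ∃ ψ : ℝ≥0 → unitInterval, IsGenerator ψ ∧
    ∀ x, C x = (extendTop ψ (∑ i, pseudoInverse ψ (x i)) : ℝ)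

/-- The space of all `d`-dimensional Archimedean copulas, with the metric `d_∞`. -/
abbrev ArchimedeanCopula (d : ℕ) : Type := {C : Copula d // C.IsArchimedean}

/-! ### Lebesgue decomposition of a kernel into `𝕀` -/

section KernelParts

variable {α : Type*} [MeasurableSpace α]

/-- The pairs `(x, y)` such that `y` is a point mass of `K(x, ·)`. -/
def atoms (K : Kernel α unitInterval) : Set (α × unitInterval) := {p | K p.1 {p.2} ≠ 0}

theorem measurableSet_atoms (K : Kernel α unitInterval) [IsFiniteKernel K] :
    MeasurableSet (atoms K) := by
  have hD : MeasurableSet {q : (α × unitInterval) × unitInterval | q.1.2 = q.2} :=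
    measurableSet_eq_fun (by fun_prop) (by fun_prop)
  have h := Kernel.measurable_kernel_prodMk_left
    (κ := K.comap (Prod.fst : α × unitInterval → α) measurable_fst) hD
  have h3 : Measurable (fun p : α × unitInterval => K p.1 {p.2}) := by
    convert h using 2 with p
    rw [Kernel.comap_apply]
    congr 1
    ext y
    simp [eq_comm]
  exact h3 (measurableSet_singleton 0).compl

/-- The kernel `x ↦ K(x, · ∩ S_x)`, where `S_x` is the `x`-section of `S`. -/
noncomputable def restrictSections (K : Kernel α unitInterval) [IsFiniteKernel K]
    (S : Set (α × unitInterval)) (hS : MeasurableSet S) : Kernel α unitInterval where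
  toFun x := (K x).restrict (Prod.mk x ⁻¹' S)
  measurable' := by
    refine Measure.measurable_of_measurable_coe _ fun t ht => ?_
    have h := Kernel.measurable_kernel_prodMk_left (κ := K)
      ((MeasurableSet.univ.prod ht).inter hS)
    convert h using 2 with x
    rw [Measure.restrict_apply ht]
    congr 1
    ext y
    simp

instance (K : Kernel α unitInterval) [IsFiniteKernel K] (S : Set (α × unitInterval))
    (hS : MeasurableSet S) : IsFiniteKernel (restrictSections K S hS) :=
  ⟨K.bound, K.bound_lt_top, fun x =>
    (Measure.restrict_apply_le _ _).trans (Kernel.measure_le_bound K x _)⟩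

/-- The absolutely continuous part of the kernel `K` with respect to Lebesgue measure on `𝕀`. -/
noncomputable def absPart (K : Kernel α unitInterval) : Kernel α unitInterval :=
  Kernel.withDensity (Kernel.const α volume) (Kernel.rnDeriv K (Kernel.const α volume))

/-- The discrete part of the kernel `K`: the restriction of each `K(x, ·)` to its (countable) set
of point masses. -/
noncomputable def disPart (K : Kernel α unitInterval) [IsFiniteKernel K] :
    Kernel α unitInterval :=
  restrictSections K (atoms K) (measurableSet_atoms K)

/-- The singular part of the kernel `K`: the part of each `K(x, ·)` that has no point masses and is
concentrated on a Lebesgue null set. -/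
noncomputable def singPart (K : Kernel α unitInterval) [IsFiniteKernel K] :
    Kernel α unitInterval :=
  restrictSections (Kernel.singularPart K (Kernel.const α volume)) (atoms K)ᶜ
    (measurableSet_atoms K).compl

instance (K : Kernel α unitInterval) [IsFiniteKernel K] : IsFiniteKernel (absPart K) := by
  unfold absPart; infer_instance

instance (K : Kernel α unitInterval) [IsFiniteKernel K] : IsFiniteKernel (disPart K) := by
  unfold disPart; infer_instance

instance (K : Kernel α unitInterval) [IsFiniteKernel K] : IsFiniteKernel (singPart K) := by
  unfold singPart; infer_instance

end KernelParts

/-! ### The components of a copula; here the dimension is `d = n + 1` -/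

/-- The first `d - 1` coordinates. -/
def firstCoords {n : ℕ} (u : Cube (n + 1)) : Cube n := fun i => u i.castSucc

/-- The last coordinate. -/
def lastCoord {n : ℕ} (u : Cube (n + 1)) : unitInterval := u (Fin.last n)

/-- The identification of `𝕀^(d-1) × 𝕀` with `𝕀^d`. -/
def joinCoords {n : ℕ} (p : Cube n × unitInterval) : Cube (n + 1) :=
  Fin.snoc (α := fun _ => unitInterval) p.1 p.2

theorem measurable_firstCoords {n : ℕ} : Measurable (firstCoords (n := n)) := by
  unfold firstCoords; fun_prop

theorem measurable_lastCoord {n : ℕ} : Measurable (lastCoord (n := n)) := by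
  unfold lastCoord; fun_prop

theorem measurable_joinCoords {n : ℕ} : Measurable (joinCoords (n := n)) := by
  refine measurable_pi_iff.2 fun i => ?_
  refine Fin.lastCases ?_ (fun j => ?_) i
  · simpa [joinCoords] using measurable_snd
  · simp only [joinCoords, Fin.snoc_castSucc]
    fun_prop

theorem joinCoords_firstCoords_lastCoord {n : ℕ} (u : Cube (n + 1)) :
    joinCoords (firstCoords u, lastCoord u) = u := Fin.snoc_init_self u

namespace Copula

variable {n : ℕ}

/-- The measure `μ_{C^{1:d-1}}` of the marginal copula of the first `d - 1` coordinates. -/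
noncomputable def marginal (C : Copula (n + 1)) : Measure (Cube n) :=
  C.measure.map firstCoords

/-- The `(d-1)`-Markov kernel `K_C` of `C`: the regular conditional distribution of the last
coordinate given the first `d - 1` coordinates. -/
noncomputable def markovKernel (C : Copula (n + 1)) : Kernel (Cube n) unitInterval :=
  condDistrib lastCoord firstCoords C.measure

instance (C : Copula (n + 1)) : IsMarkovKernel C.markovKernel := by
  unfold markovKernel; infer_instance

/-- The absolutely continuous component
`μ_C^abs(E × F) = ∫_E K_C^abs(x, F) dμ_{C^{1:d-1}}(x)` of `μ_C`. -/
noncomputable def absComponent (C : Copula (n + 1)) : Measure (Cube (n + 1)) :=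
  (C.marginal ⊗ₘ absPart C.markovKernel).map joinCoords

/-- The discrete component `μ_C^dis(E × F) = ∫_E K_C^dis(x, F) dμ_{C^{1:d-1}}(x)` of `μ_C`. -/
noncomputable def disComponent (C : Copula (n + 1)) : Measure (Cube (n + 1)) :=
  (C.marginal ⊗ₘ disPart C.markovKernel).map joinCoords

/-- The singular component `μ_C^sing(E × F) = ∫_E K_C^sing(x, F) dμ_{C^{1:d-1}}(x)` of `μ_C`. -/
noncomputable def singComponent (C : Copula (n + 1)) : Measure (Cube (n + 1)) :=
  (C.marginal ⊗ₘ singPart C.markovKernel).map joinCoords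

/-- `C` is absolutely continuous: `C^{1:d-1}` is absolutely continuous and `μ_C^abs(𝕀^d) = 1`. -/
def IsAbsolutelyContinuous (C : Copula (n + 1)) : Prop :=
  C.marginal ≪ volume ∧ C.absComponent Set.univ = 1

/-- `C` is discrete: `C^{1:d-1}` is absolutely continuous and `μ_C^dis(𝕀^d) = 1`. -/
def IsDiscrete (C : Copula (n + 1)) : Prop :=
  C.marginal ≪ volume ∧ C.disComponent Set.univ = 1

/-- `C` is singular: `C^{1:d-1}` is absolutely continuous and `μ_C^sing(𝕀^d) = 1`. -/
def IsSingular (C : Copula (n + 1)) : Prop :=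
  C.marginal ≪ volume ∧ C.singComponent Set.univ = 1

end Copula

end Archimedean

/-! Write `d = n + 1`. The Williamson transform of a probability measure `γ` on `(0, ∞)` is `ψ(z) =
∫ (1 - z/r)₊ ^ n dγ(r)`. Let `R` have law `γ` and, given `R`, let `X` be uniform on the simplex `{x
≥ 0, ∑ x_i ≤ R}` of `ℝ^n`. The vector `(X, R - ∑ X_i)` has survival function `(z, w) ↦ ψ(∑ z_i +
w)`, so if `γ` charges every interval, applying `ψ` to each coordinate yields the law of the
Archimedean copula with generator `ψ` (`radialLaw_survival`, `exists_archimedean_of_williamson`).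

Given `X`, the law of `R` is `γ` weighted by a density, and the last coordinate `ψ(R - ∑ X_i)`
arises by a translation followed by `ψ`, which is injective and respects Lebesgue null sets in both
directions. Hence the absolutely continuous, discrete and singular parts of `γ` produce the
corresponding components of the copula, with the same masses (`components_of_lebesgueParts`), and a
part charging every interval produces a component of full support (`support_map_radialMap`).

It remains to approximate. Uniformly close generators give uniformly close copulas
(`dist_copula_le`). For an arbitrary Archimedean copula, nonnegativity of box volumes says that the
differences of `ψ` along a lattice `hℕ` are nonnegative up to order `d`. A discrete Taylor formula
then represents `ψ` on the lattice by binomial weights, which agree with the Williamson kernel up to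
a shift by `n` steps (`IsGenerator.exists_lattice_williamson`). As `h → 0`, transforms of discrete
measures `α` approximate `ψ` uniformly.

Finally `α` is mixed with a little of a discrete measure charging every interval and multiplied by
an independent factor `1 + eY`. Taking the law of `Y` to be a mixture of a uniform law, a point mass
and an atomless law on a null set prescribes the weights of the three parts at will
(`exists_lebesgueParts_near`). -/

namespace Archimedean

/-! ### Archimedean copulas and their generators -/

namespace Copula

variable {d : ℕ}

theorem measure_eval_preimage (C : Copula d) (i : Fin d) {s : Set unitInterval}
    (hs : MeasurableSet s) : C.measure {u | u i ∈ s} = volume s := by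
  rw [← C.measure_map_eval i, Measure.map_apply (measurable_pi_apply i) hs]
  rfl

theorem apply_eq_zero (C : Copula d) {u : Cube d} {i : Fin d} (h : u i = 0) : C u = 0 := by
  rw [C.apply_eq, Measure.real]
  have h1 : C.measure (Set.Iic u) ≤ C.measure {v | v i ∈ Set.Iic (0 : unitInterval)} := by
    refine measure_mono fun v hv => ?_
    have := hv i
    rw [h] at this
    exact this
  rw [measure_eval_preimage C i measurableSet_Iic] at h1
  have h2 : (volume (Set.Iic (0 : unitInterval))) = 0 := by simp
  rw [h2] at h1
  rw [le_antisymm h1 zero_le]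
  rfl

/-- A point below `u` but not below `v` has some coordinate in `(v i, u i]`, and uniform marginals
give this slab at most its width as mass. -/
theorem sub_le_sum (C : Copula d) (u v : Cube d) :
    C u - C v ≤ ∑ i, |(u i : ℝ) - v i| := by
  rw [C.apply_eq, C.apply_eq]
  have hsub : Set.Iic u ⊆ Set.Iic v ∪ ⋃ i, {w | w i ∈ Set.Ioc (v i) (u i)} := by
    intro w hw
    by_cases h : w ≤ v
    · exact Or.inl h
    · right
      rw [Pi.le_def] at h
      push Not at h
      obtain ⟨i, hi⟩ := h
      exact Set.mem_iUnion.2 ⟨i, hi, hw i⟩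
  have h1 := (measureReal_mono (μ := C.measure) hsub).trans (measureReal_union_le _ _)
  have h2 := measureReal_iUnion_fintype_le (μ := C.measure)
    (fun i => {w : Cube d | w i ∈ Set.Ioc (v i) (u i)})
  have h3 : ∀ i, C.measure.real {w : Cube d | w i ∈ Set.Ioc (v i) (u i)}
      ≤ |(u i : ℝ) - v i| := by
    intro i
    rw [Measure.real, measure_eval_preimage C i measurableSet_Ioc, unitInterval.volume_Ioc]
    rw [ENNReal.toReal_ofReal']
    exact max_le (le_abs_self _) (abs_nonneg _)
  have h4 := Finset.sum_le_sum fun i (_ : i ∈ Finset.univ) => h3 i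
  linarith

theorem abs_sub_le_sum (C : Copula d) (u v : Cube d) :
    |C u - C v| ≤ ∑ i, |(u i : ℝ) - v i| := by
  rw [abs_le]
  have h := C.sub_le_sum v u
  simp_rw [abs_sub_comm (v _ : ℝ)] at h
  exact ⟨by linarith, C.sub_le_sum u v⟩

end Copula

/-! ### Generators on their positivity set, and the copula in generator coordinates -/

namespace IsGenerator

variable {ψ : ℝ≥0 → unitInterval} (hψ : IsGenerator ψ)
include hψ

theorem exists_eq {y : unitInterval} (hy : 0 < y) : ∃ z, ψ z = y := by
  obtain ⟨b, hb⟩ := (hψ.tendsto_atTop.eventually (gt_mem_nhds hy)).exists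
  have := intermediate_value_Icc' (zero_le : 0 ≤ b) hψ.continuous.continuousOn
  obtain ⟨z, -, hz⟩ := this ⟨hb.le, by rw [hψ.map_zero]; exact unitInterval.le_one'⟩
  exact ⟨z, hz⟩

/-- Strict monotonicity is only available below the first zero of `ψ`. Continuity keeps `ψ` positive
slightly beyond `z`, which makes the inequality strict. -/
theorem lt_sInf_of_pos {z : ℝ≥0} (hz : 0 < ψ z) :
    (z : ℝ≥0∞) < sInf ((fun x : ℝ≥0 => (x : ℝ≥0∞)) '' {x | ψ x = 0}) := by
  have h1 : ∀ᶠ x in 𝓝 z, 0 < ψ x := hψ.continuous.continuousAt.eventually (lt_mem_nhds hz)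
  obtain ⟨b, hb, hb'⟩ := exists_Ico_subset_of_mem_nhds h1 ⟨z + 1, by simp⟩
  refine lt_of_lt_of_le (ENNReal.coe_lt_coe.2 hb) (le_sInf ?_)
  rintro _ ⟨x, hx, rfl⟩
  simp only [ENNReal.coe_le_coe]
  by_contra! hxb
  have hx0 : ψ x = 0 := hx
  rcases le_total x z with h | h
  · have := hψ.antitone h
    rw [hx0] at this
    exact absurd hz (not_lt.2 this)
  · have : 0 < ψ x := hb' ⟨h, hxb⟩
    exact this.ne' hx0

theorem eq_of_pos {z z' : ℝ≥0} (hz : 0 < ψ z) (h : ψ z' = ψ z) : z' = z :=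
  hψ.strictAntiOn.injOn (hψ.lt_sInf_of_pos (h ▸ hz)) (hψ.lt_sInf_of_pos hz) h

theorem pseudoInverse_apply {z : ℝ≥0} (hz : 0 < ψ z) : pseudoInverse ψ (ψ z) = z := by
  have : {x | extendTop ψ x = ψ z} = {(z : ℝ≥0∞)} := by
    ext x
    simp only [Set.mem_ofPred_eq, Set.mem_singleton_iff, extendTop]
    split_ifs with hx
    · subst hx
      simp [hz.ne]
    · lift x to ℝ≥0 using hx
      simp only [ENNReal.toNNReal_coe, ENNReal.coe_inj]
      exact ⟨hψ.eq_of_pos hz, fun h => h ▸ rfl⟩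
  rw [pseudoInverse, this, sInf_singleton]

/-- Parametrising the cube by `ψ` eliminates the pseudo-inverse. If some `ψ (z i)` vanishes,
monotonicity makes both sides zero, so generators with a finite zero need no separate treatment. -/
theorem copula_apply {d : ℕ} {C : Copula d}
    (hC : ∀ x, C x = (extendTop ψ (∑ i, pseudoInverse ψ (x i)) : ℝ)) (z : Fin d → ℝ≥0) :
    C (fun i => ψ (z i)) = ψ (∑ i, z i) := by
  by_cases h : ∀ i, 0 < ψ (z i)
  · rw [hC]
    simp_rw [hψ.pseudoInverse_apply (h _)]
    rw [← ENNReal.ofNNReal_finsetSum, extendTop, if_neg ENNReal.coe_ne_top,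
      ENNReal.toNNReal_coe]
  · push Not at h
    obtain ⟨i, hi⟩ := h
    have hi0 : ψ (z i) = 0 := le_antisymm hi unitInterval.nonneg'
    rw [C.apply_eq_zero (i := i) hi0]
    have : ψ (∑ i, z i) ≤ ψ (z i) :=
      hψ.antitone (Finset.single_le_sum (fun _ _ => zero_le) (Finset.mem_univ i))
    have h0 : ψ (∑ i, z i) = 0 := le_antisymm (this.trans hi) unitInterval.nonneg'
    rw [h0]
    rfl

end IsGenerator

/-- At `u = ψ(z)` the value `C(u) = ψ(∑ z)` is within `δ` of `ψ'(∑ z) = C'(ψ'(z))`, and the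
Lipschitz bound for `C'` passes from `ψ'(z)` to `ψ(z)` at cost `d * δ`. The value `0` need not be
attained by `ψ`, but both copulas vanish when a coordinate is `0`. -/
theorem dist_copula_le {d : ℕ} {C C' : Copula d} {ψ ψ' : ℝ≥0 → unitInterval}
    (hψ : IsGenerator ψ) (hψ' : IsGenerator ψ')
    (hC : ∀ x, C x = (extendTop ψ (∑ i, pseudoInverse ψ (x i)) : ℝ))
    (hC' : ∀ x, C' x = (extendTop ψ' (∑ i, pseudoInverse ψ' (x i)) : ℝ))
    {δ : ℝ} (hδ : ∀ z, |(ψ z : ℝ) - ψ' z| ≤ δ) : dist C C' ≤ (d + 1) * δ := by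
  have hδ0 : 0 ≤ δ := (abs_nonneg _).trans (hδ 0)
  have : Nonempty (Cube d) := ⟨fun _ => 0⟩
  rw [Copula.dist_def]
  refine ciSup_le fun u => ?_
  by_cases hu : ∀ i, 0 < u i
  · choose z hz using fun i => hψ.exists_eq (hu i)
    have hu' : u = fun i => ψ (z i) := funext fun i => (hz i).symm
    have h1 := C'.abs_sub_le_sum (fun i => ψ (z i)) (fun i => ψ' (z i))
    have h2 : ∑ i, |(ψ (z i) : ℝ) - ψ' (z i)| ≤ d * δ := by
      refine (Finset.sum_le_sum fun i _ => hδ (z i)).trans ?_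
      simp
    have h3 := hδ (∑ i, z i)
    rw [hu', hψ.copula_apply hC]
    rw [hψ'.copula_apply hC'] at h1
    rw [abs_le] at *
    constructor <;> linarith
  · push Not at hu
    obtain ⟨i, hi⟩ := hu
    have hi0 : u i = 0 := le_antisymm hi unitInterval.nonneg'
    rw [C.apply_eq_zero hi0, C'.apply_eq_zero hi0]
    simp only [sub_self, abs_zero]
    positivity

/-! ### Williamson transforms -/

/-- The kernel `(1 - z / r)₊ ^ n` of the Williamson transform. -/
noncomputable def williamsonKernel (n : ℕ) (z r : ℝ) : ℝ := (max 0 (1 - z / r)) ^ n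

/-- The Williamson transform `z ↦ ∫ (1 - z / r)₊ ^ n dγ(r)` of a measure `γ` on `(0, ∞)`. -/
noncomputable def williamson (n : ℕ) (γ : Measure ℝ) (z : ℝ) : ℝ := ∫ r, williamsonKernel n z r ∂γ

theorem williamsonKernel_nonneg (n : ℕ) (z r : ℝ) : 0 ≤ williamsonKernel n z r := by
  unfold williamsonKernel; positivity

theorem williamsonKernel_le_one (n : ℕ) {z r : ℝ} (hz : 0 ≤ z) (hr : 0 < r) :
    williamsonKernel n z r ≤ 1 := by
  have : 0 ≤ z / r := by positivity
  exact pow_le_one₀ (le_max_left _ _) (max_le zero_le_one (by linarith))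

theorem williamsonKernel_antitone (n : ℕ) {z z' r : ℝ} (hr : 0 < r) (h : z ≤ z') :
    williamsonKernel n z' r ≤ williamsonKernel n z r := by
  unfold williamsonKernel
  gcongr

theorem measurable_williamsonKernel (n : ℕ) (z : ℝ) : Measurable (williamsonKernel n z) := by
  unfold williamsonKernel; fun_prop

theorem continuous_williamsonKernel (n : ℕ) (r : ℝ) :
    Continuous fun z => williamsonKernel n z r := by
  unfold williamsonKernel; fun_prop

section

variable {γ : Measure ℝ} [IsProbabilityMeasure γ] (hγ : ∀ᵐ r ∂γ, 0 < r) (n : ℕ)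
include hγ

omit [IsProbabilityMeasure γ] in
theorem norm_williamsonKernel_le {z : ℝ} (hz : 0 ≤ z) :
    ∀ᵐ r ∂γ, ‖williamsonKernel n z r‖ ≤ 1 := by
  filter_upwards [hγ] with r hr
  rw [Real.norm_of_nonneg (williamsonKernel_nonneg _ _ _)]
  exact williamsonKernel_le_one n hz hr

theorem integrable_williamsonKernel {z : ℝ} (hz : 0 ≤ z) :
    Integrable (williamsonKernel n z) γ :=
  Integrable.of_bound (measurable_williamsonKernel n z).aestronglyMeasurable 1
    (norm_williamsonKernel_le hγ n hz)

theorem williamson_antitoneOn : AntitoneOn (williamson n γ) (Set.Ici 0) := by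
  intro z hz z' hz' h
  refine integral_mono_ae (integrable_williamsonKernel hγ n hz')
    (integrable_williamsonKernel hγ n hz) ?_
  filter_upwards [hγ] with r hr
  exact williamsonKernel_antitone n hr h

theorem ofReal_williamson {z : ℝ} (hz : 0 ≤ z) :
    ENNReal.ofReal (williamson n γ z) = ∫⁻ r, ENNReal.ofReal (williamsonKernel n z r) ∂γ :=
  ofReal_integral_eq_lintegral_ofReal (integrable_williamsonKernel hγ n hz)
    (ae_of_all _ fun r => williamsonKernel_nonneg n z r)

omit [IsProbabilityMeasure γ] hγ in
theorem williamson_nonneg (z : ℝ) : 0 ≤ williamson n γ z :=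
  integral_nonneg fun r => williamsonKernel_nonneg n z r

theorem williamson_le_one {z : ℝ} (hz : 0 ≤ z) : williamson n γ z ≤ 1 := by
  have := integral_mono_ae (integrable_williamsonKernel hγ n hz) (integrable_const (μ := γ) (1 : ℝ)) (by
    filter_upwards [hγ] with r hr
    exact williamsonKernel_le_one n hz hr)
  simpa [williamson] using this

end

/-! ### Iterated differences -/

/-- The iterated backward differences of a sequence. -/
def iterDiff (a : ℕ → ℝ) : ℕ → ℕ → ℝ
  | 0, m => a m
  | i + 1, m => iterDiff a i m - iterDiff a i (m + 1)

theorem tendsto_iterDiff {a : ℕ → ℝ} (ha : Tendsto a atTop (𝓝 0)) (i : ℕ) :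
    Tendsto (iterDiff a i) atTop (𝓝 0) := by
  induction i with
  | zero => exact ha
  | succ i ih =>
    have h := ih.sub (ih.comp (tendsto_add_atTop_nat 1))
    rwa [sub_zero] at h

theorem hasSum_iterDiff {a : ℕ → ℝ} (ha : Tendsto a atTop (𝓝 0)) {i : ℕ}
    (hi : ∀ m, 0 ≤ iterDiff a (i + 1) m) (z : ℕ) :
    HasSum (fun m => iterDiff a (i + 1) (z + m)) (iterDiff a i z) := by
  rw [hasSum_iff_tendsto_nat_of_nonneg (fun m => hi _)]
  have : ∀ N, ∑ m ∈ Finset.range N, iterDiff a (i + 1) (z + m)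
      = iterDiff a i z - iterDiff a i (z + N) := fun N =>
    Finset.sum_range_sub' (fun m => iterDiff a i (z + m)) N
  simp_rw [this]
  have h := (tendsto_iterDiff ha i).comp (tendsto_add_atTop_nat z)
  simpa [Function.comp_def, add_comm] using h.const_sub (iterDiff a i z)

theorem ofReal_iterDiff {a : ℕ → ℝ} (ha : Tendsto a atTop (𝓝 0)) {i : ℕ}
    (hi : ∀ m, 0 ≤ iterDiff a (i + 1) m) (z : ℕ) :
    ENNReal.ofReal (iterDiff a i z) = ∑' m, ENNReal.ofReal (iterDiff a (i + 1) (z + m)) := by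
  have h := hasSum_iterDiff ha hi z
  rw [← h.tsum_eq, ENNReal.ofReal_tsum_of_nonneg (fun m => hi _) h.summable]

/-- Collecting terms along `m + l = N`, the hockey-stick identity sums the binomial coefficients. -/
theorem tsum_choose_mul_tsum_add (b : ℕ → ℝ≥0∞) (i : ℕ) :
    ∑' m : ℕ, ((m + i).choose i : ℝ≥0∞) * ∑' l, b (m + l)
      = ∑' m : ℕ, ((m + (i + 1)).choose (i + 1) : ℝ≥0∞) * b m := by
  calc ∑' m : ℕ, ((m + i).choose i : ℝ≥0∞) * ∑' l, b (m + l)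
      = ∑' p : ℕ × ℕ, ((p.1 + i).choose i : ℝ≥0∞) * b (p.1 + p.2) := by
        rw [ENNReal.tsum_prod']
        simp_rw [ENNReal.tsum_mul_left]
    _ = ∑' N, ∑' p : Finset.HasAntidiagonal.antidiagonal N,
          ((p.1.1 + i).choose i : ℝ≥0∞) * b (p.1.1 + p.1.2) := by
        rw [← Finset.HasAntidiagonal.sigmaAntidiagonalEquivProd.tsum_eq, ENNReal.tsum_sigma']
        rfl
    _ = _ := by
        refine tsum_congr fun N => ?_
        rw [Finset.tsum_subtype (Finset.HasAntidiagonal.antidiagonal N)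
          (fun p => ((p.1 + i).choose i : ℝ≥0∞) * b (p.1 + p.2))]
        rw [← add_assoc, ← Nat.sum_range_add_choose, Nat.cast_sum, Finset.sum_mul,
          ← Finset.Nat.sum_antidiagonal_eq_sum_range_succ_mk
            (fun p => ((p.1 + i).choose i : ℝ≥0∞) * b N)]
        refine Finset.sum_congr rfl fun p hp => ?_
        rw [Finset.HasAntidiagonal.mem_antidiagonal.1 hp]

/-- A discrete Taylor formula: each further order replaces a difference by the tail sum of the next
one and raises the binomial index. Boundary terms vanish because `a` tends to `0`, and nonnegativity
allows free rearrangement in `ℝ≥0∞`. -/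
theorem ofReal_eq_tsum_choose_mul_iterDiff {a : ℕ → ℝ} (ha : Tendsto a atTop (𝓝 0)) (n : ℕ)
    (h : ∀ i ≤ n + 1, ∀ m, 0 ≤ iterDiff a i m) (z : ℕ) :
    ENNReal.ofReal (a z)
      = ∑' m : ℕ, ((m + n).choose n : ℝ≥0∞) * ENNReal.ofReal (iterDiff a (n + 1) (z + m)) := by
  induction n with
  | zero => simpa [iterDiff] using ofReal_iterDiff ha (h 1 le_rfl) z
  | succ n ih =>
    rw [ih fun i hi => h i (by omega)]
    simp_rw [ofReal_iterDiff ha (h (n + 2) le_rfl), add_assoc z]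
    exact tsum_choose_mul_tsum_add
      (fun m => ENNReal.ofReal (iterDiff a (n + 1 + 1) (z + m))) n

/-! ### Box volumes as differences of the generator -/

/-- Putting `i` into `S` removes the box whose index `k i` is raised by one. As the volume depends
on `∑ k` only, this is one backward difference. -/
theorem IsGenerator.measure_boxes {ψ : ℝ≥0 → unitInterval} (hψ : IsGenerator ψ) {d : ℕ}
    {C : Copula d} (hC : ∀ x, C x = (extendTop ψ (∑ i, pseudoInverse ψ (x i)) : ℝ)) (h : ℝ≥0)
    (S : Finset (Fin d)) (k : Fin d → ℕ) :
    C.measure.real {u | ∀ i, u i ≤ ψ (h * k i) ∧ (i ∈ S → ψ (h * (k i + 1 : ℕ)) < u i)}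
      = iterDiff (fun m => (ψ (h * m) : ℝ)) S.card (∑ i, k i) := by
  classical
  induction S using Finset.induction_on generalizing k with
  | empty =>
    have h1 := hψ.copula_apply hC (fun i => h * k i)
    rw [C.apply_eq] at h1
    rw [← Finset.mul_sum, ← Nat.cast_sum] at h1
    rw [Finset.card_empty, iterDiff, ← h1]
    congr 1
    ext u
    simp [Pi.le_def]
  | insert i S hi ih =>
    rw [Finset.card_insert_of_notMem hi, iterDiff]
    have hsum : ∑ j, k j + 1 = ∑ j, (Function.update k i (k i + 1)) j := by
      rw [Finset.sum_update_of_mem (Finset.mem_univ i),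
        ← Finset.add_sum_erase _ _ (Finset.mem_univ i), Finset.sdiff_singleton_eq_erase]
      ring
    have hanti : ψ (h * (k i + 1 : ℕ)) ≤ ψ (h * k i) :=
      hψ.antitone (mul_le_mul_of_nonneg_left (by simp) zero_le)
    rw [hsum, ← ih k, ← ih (Function.update k i (k i + 1)), ← measureReal_sdiff]
    · congr 1
      ext u
      simp only [Set.mem_ofPred_eq, Set.mem_sdiff]
      constructor
      · intro hu
        refine ⟨fun j => ⟨(hu j).1, fun hj => (hu j).2 (Finset.mem_insert_of_mem hj)⟩, ?_⟩
        intro hu'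
        have h1 := (hu' i).1
        rw [Function.update_self] at h1
        exact absurd ((hu i).2 (Finset.mem_insert_self i S)) (not_lt.2 h1)
      · rintro ⟨hu, hu'⟩ j
        refine ⟨(hu j).1, fun hj => ?_⟩
        rcases Finset.mem_insert.1 hj with rfl | hj
        · by_contra! hle
          refine hu' fun l => ?_
          by_cases hl : l = j
          · subst hl
            simpa [hi] using hle
          · simpa [hl] using hu l
        · exact (hu j).2 hj
    · intro u hu l
      have hl := hu l
      by_cases hli : l = i
      · subst hli
        simp only [Function.update_self] at hl
        exact ⟨hl.1.trans hanti, fun h => absurd h hi⟩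
      · simpa [hli] using hl
    · have : {u : Cube d | ∀ j, u j ≤ ψ (h * Function.update k i (k i + 1) j) ∧
          (j ∈ S → ψ (h * (Function.update k i (k i + 1) j + 1 : ℕ)) < u j)} =
          ⋂ j, ({u : Cube d | u j ≤ ψ (h * Function.update k i (k i + 1) j)} ∩
            {u | j ∈ S → ψ (h * (Function.update k i (k i + 1) j + 1 : ℕ)) < u j}) := by
        ext u; simp
      rw [this]
      refine MeasurableSet.iInter fun j => MeasurableSet.inter
        (measurableSet_le (measurable_pi_apply j) measurable_const) ?_
      by_cases hj : j ∈ S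
      · simpa [hj] using measurableSet_lt measurable_const (measurable_pi_apply j)
      · simp [hj]

theorem IsGenerator.iterDiff_nonneg {ψ : ℝ≥0 → unitInterval} (hψ : IsGenerator ψ) {n : ℕ}
    {C : Copula (n + 1)} (hC : ∀ x, C x = (extendTop ψ (∑ i, pseudoInverse ψ (x i)) : ℝ))
    (h : ℝ≥0) {i : ℕ} (hi : i ≤ n + 1) (m : ℕ) :
    0 ≤ iterDiff (fun m => (ψ (h * m) : ℝ)) i m := by
  obtain ⟨S, -, hS⟩ := Finset.exists_subset_card_eq (s := (Finset.univ : Finset (Fin (n + 1))))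
    (n := i) (by simpa using hi)
  -- Only the sum of the indices matters, so all of `m` is placed on one coordinate.
  have := hψ.measure_boxes hC h S (Pi.single 0 m)
  rw [hS, Finset.sum_pi_single'] at this
  simp only [Finset.mem_univ, if_true] at this
  rw [← this]
  exact measureReal_nonneg

/-! ### Lattice approximation -/

/-- After multiplication by `n!` the factors compare one by one, since `(z + l + 1)(l + 1 + j) - (l
+ 1)(z + l + 1 + j) = z j`. With `m = z + l` this bounds `(1 - z/(m+1))^n` by a quotient of binomial
coefficients. -/
theorem pow_mul_choose_le (n l z : ℕ) :
    (l + 1) ^ n * (z + l + n).choose n ≤ (z + l + 1) ^ n * (l + n).choose n := by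
  refine Nat.le_of_mul_le_mul_left ?_ (Nat.factorial_pos n)
  rw [mul_left_comm, ← Nat.ascFactorial_eq_factorial_mul_choose, mul_left_comm,
    ← Nat.ascFactorial_eq_factorial_mul_choose, Nat.ascFactorial_eq_prod_range,
    Nat.ascFactorial_eq_prod_range,
    Finset.pow_eq_prod_const, Finset.pow_eq_prod_const, ← Finset.prod_mul_distrib,
    ← Finset.prod_mul_distrib]
  refine Finset.prod_le_prod' fun j _ => ?_
  nlinarith [Nat.zero_le (z * j)]

/-- The reverse comparison, which costs a shift by `n`: each factor `l + 1 + j` is at most `n + l +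
1` because `j < n`. -/
theorem choose_mul_pow_le (n l y : ℕ) :
    (l + n).choose n * (y + n + l + 1) ^ n ≤ (y + n + l + n).choose n * (n + l + 1) ^ n := by
  refine Nat.le_of_mul_le_mul_left ?_ (Nat.factorial_pos n)
  rw [← mul_assoc, ← Nat.ascFactorial_eq_factorial_mul_choose, ← mul_assoc,
    ← Nat.ascFactorial_eq_factorial_mul_choose, Nat.ascFactorial_eq_prod_range,
    Nat.ascFactorial_eq_prod_range,
    Finset.pow_eq_prod_const, Finset.pow_eq_prod_const, ← Finset.prod_mul_distrib,
    ← Finset.prod_mul_distrib]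
  refine Finset.prod_le_prod' fun j hj => ?_
  have := Finset.mem_range.1 hj
  have h1 : l + 1 + j ≤ n + l + 1 := by omega
  have h2 : y + n + l + 1 ≤ y + n + l + 1 + j := by omega
  rw [mul_comm]
  exact Nat.mul_le_mul h2 h1

theorem tsum_add_eq_tsum_ite (f g : ℕ → ℝ≥0∞) (z : ℕ) :
    ∑' l, f l * g (z + l) = ∑' m, if z ≤ m then f (m - z) * g m else 0 := by
  have h := (add_right_injective z).tsum_eq (f := fun m => if z ≤ m then f (m - z) * g m else 0)
    (by
      intro m hm
      have : z ≤ m := by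
        by_contra h
        simp [h] at hm
      exact ⟨m - z, by simp only; omega⟩)
  rw [← h]
  simp

theorem choose_mul_williamsonKernel_le {n m z : ℕ} {h : ℝ} (hh : 0 < h) (hn : n ≠ 0) :
    ((m + n).choose n : ℝ) * williamsonKernel n (h * z) (h * (m + 1))
      ≤ if z ≤ m then ((m - z + n).choose n : ℝ) else 0 := by
  unfold williamsonKernel
  rw [mul_div_mul_left _ _ hh.ne']
  have hm : (0 : ℝ) < m + 1 := by positivity
  split_ifs with hz
  · obtain ⟨l, rfl⟩ := Nat.exists_eq_add_of_le hz
    rw [Nat.add_sub_cancel_left]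
    have h1 : (1 : ℝ) - z / ((z + l : ℕ) + 1) = (l + 1) / ((z + l : ℕ) + 1) := by
      field_simp; push_cast; ring
    rw [h1, max_eq_right (by positivity), div_pow, mul_div_assoc', div_le_iff₀ (by positivity)]
    have := pow_mul_choose_le n l z
    have h2 : ((l : ℝ) + 1) ^ n * ((z + l + n).choose n : ℝ)
      ≤ ((z : ℝ) + l + 1) ^ n * ((l + n).choose n : ℝ) := by exact_mod_cast this
    push_cast
    linarith
  -- The kernel is `0 ^ n` here, which vanishes because `n ≠ 0`.
  · rw [max_eq_left]
    · simp [hn]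
    · rw [sub_nonpos, one_le_div hm]
      exact_mod_cast (not_le.1 hz)

theorem le_choose_mul_williamsonKernel {n m y : ℕ} {h : ℝ} (hh : 0 < h) :
    (if y + n ≤ m then ((m - (y + n) + n).choose n : ℝ) else 0) ≤
    ((m + n).choose n : ℝ) * williamsonKernel n (h * y) (h * (m + 1)) := by
  split_ifs with hz
  · unfold williamsonKernel
    rw [mul_div_mul_left _ _ hh.ne']
    obtain ⟨l, rfl⟩ := Nat.exists_eq_add_of_le hz
    rw [Nat.add_sub_cancel_left]
    have h1 : (1 : ℝ) - y / ((y + n + l : ℕ) + 1) = (n + l + 1) / ((y + n + l : ℕ) + 1) := by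
      field_simp; push_cast; ring
    rw [h1, max_eq_right (by positivity), div_pow, mul_div_assoc', le_div_iff₀ (by positivity)]
    have := choose_mul_pow_le n l y
    have h2 : ((l + n).choose n : ℝ) * ((y : ℝ) + n + l + 1) ^ n
      ≤ ((y + n + l + n).choose n : ℝ) * ((n : ℝ) + l + 1) ^ n := by exact_mod_cast this
    push_cast
    linarith
  · exact mul_nonneg (Nat.cast_nonneg _) (williamsonKernel_nonneg _ _ _)

/-- The generator of an Archimedean copula lies between lattice values of a Williamson transform of
a discrete measure. -/
theorem IsGenerator.exists_lattice_williamson {ψ : ℝ≥0 → unitInterval} (hψ : IsGenerator ψ)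
    {n : ℕ} (hn : n ≠ 0) {C : Copula (n + 1)}
    (hC : ∀ x, C x = (extendTop ψ (∑ i, pseudoInverse ψ (x i)) : ℝ)) {h : ℝ≥0} (hh : 0 < h) :
    ∃ α : Measure ℝ, IsProbabilityMeasure α ∧ (∀ᵐ r ∂α, 0 < r) ∧
      (∃ D : Set ℝ, D.Countable ∧ α Dᶜ = 0) ∧
      ∀ y : ℕ, williamson n α (h * y) ≤ ψ (h * y) ∧
        (ψ (h * (y + n : ℕ)) : ℝ) ≤ williamson n α (h * y) := by
  have hh' : (0 : ℝ) < h := hh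
  set a : ℕ → ℝ := fun m => (ψ (h * m) : ℝ) with ha
  have ha0 : Tendsto a atTop (𝓝 0) := by
    have h1 : Tendsto (fun m : ℕ => h * (m : ℝ≥0)) atTop atTop :=
      Tendsto.const_mul_atTop hh tendsto_natCast_atTop_atTop
    exact (continuous_subtype_val.tendsto' (0 : unitInterval) (0 : ℝ) rfl).comp
      (hψ.tendsto_atTop.comp h1)
  set b : ℕ → ℝ≥0∞ := fun m => ENNReal.ofReal (iterDiff a (n + 1) m) with hb
  have hsum : ∀ z, ENNReal.ofReal (a z) = ∑' m : ℕ, ((m + n).choose n : ℝ≥0∞) * b (z + m) :=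
    ofReal_eq_tsum_choose_mul_iterDiff ha0 n fun i hi m => hψ.iterDiff_nonneg hC h hi m
  -- The weights are those of the Taylor formula at `0`, so the total mass is `ψ 0 = 1`. Atoms at `h
  -- (m + 1)` instead of `h m` are positive, and the kernel at `h z` vanishes exactly for `z > m`,
  -- where the formula at `z` has no term either.
  set α : Measure ℝ := Measure.sum fun m : ℕ =>
    (((m + n).choose n : ℝ≥0∞) * b m) • Measure.dirac ((h : ℝ) * (m + 1)) with hα
  have hprob : IsProbabilityMeasure α := by
    constructor
    rw [hα, Measure.sum_apply _ MeasurableSet.univ]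
    have := hsum 0
    simp only [zero_add] at this
    simp [← this, ha, hψ.map_zero]
  have hae : ∀ p : ℝ → Prop, (∀ m : ℕ, p (h * (m + 1))) → MeasurableSet {x | p x} → ∀ᵐ r ∂α, p r := by
    intro p hp hpm
    rw [hα, Measure.ae_sum_iff' hpm]
    intro m
    refine Measure.ae_smul_measure ?_ _
    rw [ae_dirac_iff hpm]
    exact hp m
  have hpos : ∀ᵐ r ∂α, 0 < r := hae _ (fun m => by positivity) measurableSet_Ioi
  refine ⟨α, hprob, hpos, ⟨Set.range fun m : ℕ => (h : ℝ) * (m + 1), Set.countable_range _, ?_⟩, ?_⟩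
  · have hc := Set.countable_range fun m : ℕ => (h : ℝ) * (m + 1)
    exact hae (fun r => r ∈ Set.range fun m : ℕ => (h : ℝ) * (m + 1)) (fun m => ⟨m, rfl⟩)
      hc.measurableSet
  · intro y
    have hW : ENNReal.ofReal (williamson n α (h * y)) = ∑' m : ℕ,
        ENNReal.ofReal ((m + n).choose n * williamsonKernel n (h * y) (h * (m + 1))) * b m := by
      rw [ofReal_williamson hpos n (by positivity), hα, lintegral_sum_measure]
      refine tsum_congr fun m => ?_
      rw [lintegral_smul_measure, lintegral_dirac, smul_eq_mul,
        ENNReal.ofReal_mul (Nat.cast_nonneg _), ENNReal.ofReal_natCast]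
      ring
    have hA : ∀ z, ENNReal.ofReal (a z) = ∑' m : ℕ,
        ENNReal.ofReal (if z ≤ m then ((m - z + n).choose n : ℝ) else 0) * b m := by
      intro z
      rw [hsum, tsum_add_eq_tsum_ite]
      refine tsum_congr fun m => ?_
      split_ifs <;> simp
    constructor
    · have : ENNReal.ofReal (williamson n α (h * y)) ≤ ENNReal.ofReal (a y) := by
        rw [hW, hA]
        gcongr with m
        exact choose_mul_williamsonKernel_le hh' hn
      exact (ENNReal.ofReal_le_ofReal_iff (ψ (h * y)).2.1).1 this
    · have : ENNReal.ofReal (a (y + n)) ≤ ENNReal.ofReal (williamson n α (h * y)) := by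
        rw [hW, hA]
        gcongr with m
        exact le_choose_mul_williamsonKernel hh'
      exact (ENNReal.ofReal_le_ofReal_iff (williamson_nonneg _ _)).1 this

theorem IsGenerator.uniformContinuous {ψ : ℝ≥0 → unitInterval} (hψ : IsGenerator ψ) :
    UniformContinuous ψ :=
  hψ.continuous.uniformContinuous_of_tendsto_cocompact
    (by rw [cocompact_eq_atTop]; exact hψ.tendsto_atTop)

/-- The generator of an Archimedean copula is a uniform limit of Williamson transforms of discrete
measures. -/
theorem IsGenerator.exists_williamson_near {ψ : ℝ≥0 → unitInterval} (hψ : IsGenerator ψ)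
    {n : ℕ} (hn : n ≠ 0) {C : Copula (n + 1)}
    (hC : ∀ x, C x = (extendTop ψ (∑ i, pseudoInverse ψ (x i)) : ℝ)) {δ : ℝ} (hδ : 0 < δ) :
    ∃ α : Measure ℝ, IsProbabilityMeasure α ∧ (∀ᵐ r ∂α, 0 < r) ∧
      (∃ D : Set ℝ, D.Countable ∧ α Dᶜ = 0) ∧
      ∀ z : ℝ≥0, |(ψ z : ℝ) - williamson n α z| ≤ δ := by
  obtain ⟨η, hη, hη'⟩ := Metric.uniformContinuous_iff.1 hψ.uniformContinuous δ hδ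
  -- With `l = ⌊z / h⌋`, the transform at `z` lies between `ψ (h (l + 1 + n))` and `ψ (h l)`, and
  -- both arguments are within `h (n + 2)` of `z`.
  obtain ⟨h, hh, hhη⟩ : ∃ h : ℝ≥0, 0 < h ∧ (h : ℝ) * (n + 2) < η := by
    have h0 : 0 < η / (2 * (n + 2)) := by positivity
    refine ⟨(η / (2 * (n + 2))).toNNReal, Real.toNNReal_pos.2 h0, ?_⟩
    rw [Real.coe_toNNReal _ h0.le]
    have : η / (2 * (n + 2)) * (n + 2) = η / 2 := by field_simp
    linarith
  obtain ⟨α, hα, hpos, hD, hW⟩ := hψ.exists_lattice_williamson hn hC hh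
  refine ⟨α, hα, hpos, hD, fun z => ?_⟩
  set l := ⌊z / h⌋₊ with hl
  have h1 : h * l ≤ z := by
    have := Nat.floor_le (zero_le : 0 ≤ z / h)
    rwa [le_div_iff₀ hh, mul_comm] at this
  have h2 : z < h * (l + 1 : ℕ) := by
    have := Nat.lt_floor_add_one (z / h)
    rw [div_lt_iff₀ hh, mul_comm] at this
    exact_mod_cast this
  have hclose : ∀ w : ℝ≥0, |(w : ℝ) - z| < η → |(ψ w : ℝ) - ψ z| < δ := fun w hw => hη' hw
  have h1' : (h : ℝ) * l ≤ z := by exact_mod_cast h1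
  have h2' : (z : ℝ) < h * (l + 1) := by exact_mod_cast h2
  have hhr : (0 : ℝ) < h := hh
  have c1 := hclose (h * l) (by
    rw [abs_lt]; push_cast; constructor <;> nlinarith [(Nat.cast_nonneg n : (0 : ℝ) ≤ n)])
  have c2 := hclose (h * (l + 1 + n : ℕ)) (by
    rw [abs_lt]; push_cast
    constructor <;> nlinarith [mul_nonneg hhr.le (Nat.cast_nonneg n : (0 : ℝ) ≤ n)])
  have a1 : williamson n α z ≤ williamson n α (h * l) :=
    williamson_antitoneOn hpos n (Set.mem_Ici.2 (by positivity)) z.2 h1'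
  have a2 : williamson n α (h * (l + 1 : ℕ)) ≤ williamson n α z :=
    williamson_antitoneOn hpos n z.2 (Set.mem_Ici.2 (by positivity)) (by exact_mod_cast h2.le)
  have b1 := (hW l).1
  have b2 := (hW (l + 1)).2
  rw [abs_lt] at c1 c2
  rw [abs_le]
  constructor <;> linarith

/-! ### Mixtures of rescaled measures -/

/-- There is a probability measure without atoms on a Lebesgue null set of `[0, 1]`. -/
theorem exists_nullSingletonClass_singular : ∃ (σ : Measure ℝ) (N : Set ℝ), IsProbabilityMeasure σ ∧
    NullSingletonClass σ ∧ MeasurableSet N ∧ volume N = 0 ∧ σ Nᶜ = 0 ∧ ∀ᵐ y ∂σ, y ∈ Set.Icc (0 : ℝ) 1 := by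
  -- The Liouville numbers are Lebesgue null but residual, so uncountably many lie in `(0, 1)`. A
  -- Borel isomorphism with `ℝ` then transports Lebesgue measure on `[0, 1]` to `N` without creating
  -- atoms.
  set N : Set ℝ := {x | Liouville x} ∩ Set.Ioo 0 1 with hN
  have hNm : MeasurableSet N := IsGδ.setOfPred_liouville.measurableSet.inter measurableSet_Ioo
  have hN0 : volume N = 0 := measure_mono_null Set.inter_subset_left volume_setOfPred_liouville
  have hNc : ¬ N.Countable := by
    intro hc
    have h1 : Nᶜ ∈ residual ℝ := residual_of_dense_Gδ hc.isGδ_compl (hc.dense_compl ℝ)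
    have h2 : Nᶜ ∩ {x | Liouville x} ∈ residual ℝ := inter_mem h1 eventually_residual_liouville
    obtain ⟨x, hx, hx', hx''⟩ := (dense_of_mem_residual h2).exists_mem_open
      (isOpen_Ioo (a := (0 : ℝ)) (b := 1)) ⟨1 / 2, by norm_num⟩
    exact hx.1 ⟨hx.2, hx', hx''⟩
  have : StandardBorelSpace N := hNm.standardBorel
  let e : N ≃ᵐ ℝ := PolishSpace.measurableEquivOfNotCountable
    (by rwa [Set.countable_coe_iff]) (by
      rw [← Set.countable_univ_iff]; exact Cardinal.not_countable_real)
  have hem : Measurable fun x : ℝ => (e.symm x : ℝ) := measurable_subtype_coe.comp e.symm.measurable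
  have : IsProbabilityMeasure (volume.restrict (Set.Icc (0 : ℝ) 1)) := ⟨by simp⟩
  refine ⟨(volume.restrict (Set.Icc 0 1)).map fun x => (e.symm x : ℝ), N,
    Measure.isProbabilityMeasure_map hem.aemeasurable, ⟨fun r => ?_⟩, hNm, hN0, ?_, ?_⟩
  · rw [Measure.map_apply hem (measurableSet_singleton r)]
    refine Set.Subsingleton.measure_zero (fun x hx y hy => ?_) _
    have : (e.symm x : ℝ) = e.symm y := hx.trans hy.symm
    exact e.symm.injective (Subtype.ext this)
  · rw [Measure.map_apply hem hNm.compl]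
    have : (fun x : ℝ => (e.symm x : ℝ)) ⁻¹' Nᶜ = ∅ := by
      ext x; simp
    rw [this, measure_empty]
  · rw [ae_map_iff (p := fun y => y ∈ Set.Icc (0 : ℝ) 1) hem.aemeasurable measurableSet_Icc]
    exact ae_of_all _ fun x => Set.Ioo_subset_Icc_self (e.symm x).2.2

/-- There is a discrete probability measure on `(0, ∞)` that charges every interval. -/
theorem exists_discrete_charging : ∃ ν : Measure ℝ, IsProbabilityMeasure ν ∧ (∀ᵐ r ∂ν, 0 < r) ∧
    (∃ D : Set ℝ, D.Countable ∧ ν Dᶜ = 0) ∧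
    ∀ U : Set ℝ, IsOpen U → (U ∩ Set.Ioi 0).Nonempty → 0 < ν U := by
  -- Geometric weights on a dense sequence of `(0, ∞)`.
  let q : ℕ → Set.Ioi (0 : ℝ) := TopologicalSpace.denseSeq _
  have hc : (Set.range fun k => (q k : ℝ)).Countable := Set.countable_range _
  set ν : Measure ℝ := Measure.sum fun k : ℕ => ((2⁻¹ : ℝ≥0∞) ^ (k + 1)) • Measure.dirac (q k : ℝ)
    with hν
  have hae : ∀ p : ℝ → Prop, (∀ k, p (q k)) → MeasurableSet {x | p x} → ∀ᵐ r ∂ν, p r := by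
    intro p hp hpm
    rw [hν, Measure.ae_sum_iff' hpm]
    intro m
    refine Measure.ae_smul_measure ?_ _
    rw [ae_dirac_iff hpm]
    exact hp m
  refine ⟨ν, ⟨?_⟩, hae _ (fun k => (q k).2) measurableSet_Ioi, ⟨_, hc, ?_⟩, fun U hU hU0 => ?_⟩
  · rw [hν, Measure.sum_apply _ MeasurableSet.univ]
    simp only [Measure.smul_apply, measure_univ, smul_eq_mul, mul_one]
    rw [ENNReal.tsum_geometric_add_one, ENNReal.one_sub_inv_two, inv_inv]
    exact ENNReal.inv_mul_cancel (by simp) (by simp)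
  · exact hae (fun r => r ∈ Set.range fun k => (q k : ℝ)) (fun m => ⟨m, rfl⟩) hc.measurableSet
  · obtain ⟨x, hx, hx'⟩ := hU0
    obtain ⟨k, hk⟩ := (TopologicalSpace.denseRange_denseSeq (Set.Ioi (0 : ℝ))).exists_mem_open
      (hU.preimage continuous_subtype_val) ⟨⟨x, hx'⟩, hx⟩
    rw [hν, Measure.sum_apply _ hU.measurableSet]
    refine lt_of_lt_of_le ?_ (ENNReal.le_tsum k)
    have hk' : (q k : ℝ) ∈ U := hk
    simp [Measure.dirac_apply' _ hU.measurableSet, hk', ENNReal.pow_pos]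

/-- The law of `A * (1 + ε * Y)` for independent `A ∼ β` and `Y ∼ σ`. -/
noncomputable def scaleMix (ε : ℝ) (β σ : Measure ℝ) : Measure ℝ :=
  (β.prod σ).map fun p => p.1 * (1 + ε * p.2)

section scaleMix

variable {ε : ℝ} {β σ : Measure ℝ} [IsFiniteMeasure σ]

theorem measurable_scale (ε : ℝ) : Measurable fun p : ℝ × ℝ => p.1 * (1 + ε * p.2) := by fun_prop

theorem scaleMix_apply {A : Set ℝ} (hA : MeasurableSet A) :
    scaleMix ε β σ A = ∫⁻ a, σ {y | a * (1 + ε * y) ∈ A} ∂β := by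
  rw [scaleMix, Measure.map_apply (measurable_scale ε) hA,
    Measure.prod_apply ((measurable_scale ε) hA)]
  rfl

instance [IsFiniteMeasure β] : IsFiniteMeasure (scaleMix ε β σ) := by unfold scaleMix; infer_instance

theorem scaleMix_univ [IsProbabilityMeasure β] : scaleMix ε β σ Set.univ = σ Set.univ := by
  rw [scaleMix_apply MeasurableSet.univ]; simp

theorem scaleMix_add [SFinite β] {σ' : Measure ℝ} [IsFiniteMeasure σ'] :
    scaleMix ε β (σ + σ') = scaleMix ε β σ + scaleMix ε β σ' := by
  rw [scaleMix, Measure.prod_add, Measure.map_add _ _ (measurable_scale ε)]; rfl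

theorem ae_scaleMix {p : ℝ → Prop} (hp : MeasurableSet {x | p x})
    (h : ∀ᵐ a ∂β, ∀ᵐ y ∂σ, p (a * (1 + ε * y))) : ∀ᵐ r ∂scaleMix ε β σ, p r := by
  rw [ae_iff]
  have : MeasurableSet {x | ¬ p x} := hp.compl
  rw [scaleMix_apply this]
  exact lintegral_eq_zero_of_ae_eq_zero h

theorem volume_preimage_scale {a : ℝ} (hε : ε ≠ 0) (ha : a ≠ 0) {A : Set ℝ} (hA : volume A = 0) :
    volume {y | a * (1 + ε * y) ∈ A} = 0 := by
  have : {y | a * (1 + ε * y) ∈ A} = (fun y => (a * ε) * y) ⁻¹' ((fun y => a + y) ⁻¹' A) := by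
    ext y
    simp only [Set.mem_ofPred_eq, Set.mem_preimage]
    ring_nf
  rw [this, Real.volume_preimage_mul_left (mul_ne_zero ha hε), measure_preimage_add, hA, mul_zero]

variable (hβ : ∀ᵐ a ∂β, 0 < a)

include hβ in
theorem scaleMix_absolutelyContinuous (hε : ε ≠ 0) (hσ : σ ≪ volume) :
    scaleMix ε β σ ≪ volume := by
  refine Measure.AbsolutelyContinuous.mk fun A hA hA0 => ?_
  rw [scaleMix_apply hA]
  refine lintegral_eq_zero_of_ae_eq_zero ?_
  filter_upwards [hβ] with a ha
  exact hσ (volume_preimage_scale hε ha.ne' hA0)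

theorem exists_countable_scaleMix (hβD : ∃ D : Set ℝ, D.Countable ∧ β Dᶜ = 0)
    (hσD : ∃ D : Set ℝ, D.Countable ∧ σ Dᶜ = 0) :
    ∃ D : Set ℝ, D.Countable ∧ scaleMix ε β σ Dᶜ = 0 := by
  obtain ⟨D, hD, hD0⟩ := hβD
  obtain ⟨E, hE, hE0⟩ := hσD
  have hc := hD.image2 hE fun a y => a * (1 + ε * y)
  refine ⟨_, hc, ae_scaleMix (p := fun r => r ∈ Set.image2 (fun a y => a * (1 + ε * y)) D E)
    hc.measurableSet ?_⟩
  filter_upwards [show ∀ᵐ a ∂β, a ∈ D from hD0] with a ha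
  filter_upwards [show ∀ᵐ a ∂σ, a ∈ E from hE0] with y hy
  exact ⟨a, ha, y, hy, rfl⟩

include hβ in
-- Given `A = a`, the law is carried by an affine image of `N`, which is null. Discreteness of `β`
-- enters here: only countably many such images have to be united.
theorem exists_null_scaleMix (hε : ε ≠ 0) (hβD : ∃ D : Set ℝ, D.Countable ∧ β Dᶜ = 0) {N : Set ℝ}
    (hNm : MeasurableSet N) (hN : volume N = 0) (hσN : σ Nᶜ = 0) :
    ∃ N' : Set ℝ, MeasurableSet N' ∧ volume N' = 0 ∧ scaleMix ε β σ N'ᶜ = 0 := by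
  obtain ⟨D, hD, hD0⟩ := hβD
  have hmem : ∀ {a y : ℝ}, 0 < a → (a * ε)⁻¹ * (-a + a * (1 + ε * y)) = y := by
    intro a y ha; field_simp; ring
  set N' : Set ℝ := ⋃ a ∈ D ∩ Set.Ioi 0, {r | (a * ε)⁻¹ * (-a + r) ∈ N} with hN'
  have hDc : (D ∩ Set.Ioi 0).Countable := hD.mono Set.inter_subset_left
  have hN'm : MeasurableSet N' := MeasurableSet.biUnion hDc fun a _ =>
    (show Measurable fun r => (a * ε)⁻¹ * (-a + r) by fun_prop) hNm
  refine ⟨N', hN'm, ?_, ae_scaleMix (p := fun r => r ∈ N') hN'm ?_⟩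
  · rw [measure_biUnion_null_iff hDc]
    rintro a ⟨-, ha⟩
    have ha' : (0 : ℝ) < a := ha
    have : {r | (a * ε)⁻¹ * (-a + r) ∈ N}
        = (fun y => -a + y) ⁻¹' ((fun y => (a * ε)⁻¹ * y) ⁻¹' N) := rfl
    rw [this, measure_preimage_add,
      Real.volume_preimage_mul_left (inv_ne_zero (mul_ne_zero ha'.ne' hε)), hN, mul_zero]
  · filter_upwards [hβ, show ∀ᵐ a ∂β, a ∈ D from hD0] with a ha haD
    filter_upwards [show ∀ᵐ a ∂σ, a ∈ N from hσN] with y hy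
    refine Set.mem_biUnion (show a ∈ D ∩ Set.Ioi 0 from ⟨haD, ha⟩) ?_
    change (a * ε)⁻¹ * (-a + a * (1 + ε * y)) ∈ N
    rwa [hmem ha]

include hβ in
theorem nullSingletonClass_scaleMix (hε : ε ≠ 0) [NullSingletonClass σ] : NullSingletonClass (scaleMix ε β σ) := by
  refine ⟨fun r => ?_⟩
  rw [scaleMix_apply (measurableSet_singleton r)]
  refine lintegral_eq_zero_of_ae_eq_zero ?_
  filter_upwards [hβ] with a ha
  refine Set.Subsingleton.measure_zero (fun x hx y hy => ?_) _
  have : a * (1 + ε * x) = a * (1 + ε * y) := hx.trans hy.symm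
  have := mul_left_cancel₀ ha.ne' this
  exact mul_left_cancel₀ hε (by linarith)

/-- For `y₀` in the support of `σ` and `r ∈ U` positive, continuity at `(r / (1 + ε y₀), y₀)`
provides a product of neighbourhoods mapped into `U`, both of positive mass. -/
theorem scaleMix_pos_of_isOpen (hε : 0 ≤ ε) (hσ0 : σ ≠ 0) (hσ : ∀ᵐ y ∂σ, y ∈ Set.Icc (0 : ℝ) 1)
    (hβU : ∀ U : Set ℝ, IsOpen U → (U ∩ Set.Ioi 0).Nonempty → 0 < β U) {U : Set ℝ} (hU : IsOpen U)
    (hU0 : (U ∩ Set.Ioi 0).Nonempty) : 0 < scaleMix ε β σ U := by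
  obtain ⟨y₀, hy₀⟩ := Measure.nonempty_support hσ0
  have hy₀' : y₀ ∈ Set.Icc (0 : ℝ) 1 :=
    Measure.support_subset_of_isClosed isClosed_Icc hσ hy₀
  have h1 : 0 < 1 + ε * y₀ := by nlinarith [hy₀'.1, mul_nonneg hε hy₀'.1]
  have hcont : Continuous fun p : ℝ × ℝ => p.1 * (1 + ε * p.2) := by fun_prop
  obtain ⟨r, hrU, hr⟩ := hU0
  have hr' : (0 : ℝ) < r := hr
  obtain ⟨u, v, hu, hv, hau, hyv, huv⟩ := isOpen_prod_iff.1 (hU.preimage hcont) (r / (1 + ε * y₀)) y₀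
    (by simp only [Set.mem_preimage]; rwa [div_mul_cancel₀ _ h1.ne'])
  have h2 : 0 < β.prod σ (u ×ˢ v) := by
    rw [Measure.prod_prod]
    exact ENNReal.mul_pos (hβU u hu ⟨_, hau, div_pos hr' h1⟩).ne'
      ((Measure.mem_support_iff_forall _).1 hy₀ v (hv.mem_nhds hyv)).ne'
  rw [scaleMix, Measure.map_apply (measurable_scale ε) hU.measurableSet]
  exact h2.trans_le (measure_mono huv)

/-- Put `q = z / a` and `b = q / (1 + ε y)`. Then `q - b = b ε y`, which is at most `ε` if `b ≤ 1`,
while both truncations are `0` if `b ≥ 1`. On `[0, 1]` the `n`-th power is `n`-Lipschitz. -/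
theorem abs_williamsonKernel_scale_sub_le (n : ℕ) {z a y : ℝ} (hz : 0 ≤ z) (ha : 0 < a)
    (hε : 0 ≤ ε) (hy : y ∈ Set.Icc (0 : ℝ) 1) :
    |williamsonKernel n z (a * (1 + ε * y)) - williamsonKernel n z a| ≤ n * ε := by
  have hey : 0 ≤ ε * y := mul_nonneg hε hy.1
  have hey1 : ε * y ≤ ε := by nlinarith [hy.2]
  have hpos : 0 < 1 + ε * y := by linarith
  unfold williamsonKernel
  set s := max 0 (1 - z / (a * (1 + ε * y))) with hs
  set t := max 0 (1 - z / a) with ht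
  have hq : 0 ≤ z / a := by positivity
  have hq' : z / (a * (1 + ε * y)) = z / a / (1 + ε * y) := by rw [div_div]
  have ht0 : 0 ≤ t := le_max_left _ _
  have hs1 : s ≤ 1 := max_le zero_le_one (by
    rw [hq']; have : 0 ≤ z / a / (1 + ε * y) := by positivity
    linarith)
  have hts : t ≤ s := by
    refine max_le_max le_rfl ?_
    rw [hq']
    have : z / a / (1 + ε * y) ≤ z / a := div_le_self hq (by linarith)
    linarith
  have hst : s - t ≤ ε := by
    have h1 : s ≤ t + ε := by
      refine max_le (by linarith) ?_
      rw [hq']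
      have hb : z / a / (1 + ε * y) * (1 + ε * y) = z / a := div_mul_cancel₀ _ hpos.ne'
      set b := z / a / (1 + ε * y)
      have hb0 : 0 ≤ b := by positivity
      have ht1 : 1 - z / a ≤ t := le_max_right _ _
      rcases le_total b 1 with h | h
      · nlinarith
      · linarith
    linarith
  rw [abs_of_nonneg (sub_nonneg.2 (pow_le_pow_left₀ ht0 hts n))]
  have hgeom : s ^ n - t ^ n ≤ n * (s - t) := by
    induction n with
    | zero => simp
    | succ n ih =>
      have h1 : t ^ n ≤ 1 := pow_le_one₀ ht0 (hts.trans hs1)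
      have h2 : 0 ≤ s ^ n - t ^ n := sub_nonneg.2 (pow_le_pow_left₀ ht0 hts n)
      have h3 : s ^ (n + 1) - t ^ (n + 1) = s * (s ^ n - t ^ n) + (s - t) * t ^ n := by ring
      rw [h3]
      push_cast
      have h4 : s * (s ^ n - t ^ n) ≤ s ^ n - t ^ n := mul_le_of_le_one_left h2 hs1
      have h5 : (s - t) * t ^ n ≤ s - t := mul_le_of_le_one_right (sub_nonneg.2 hts) h1
      linarith
  exact hgeom.trans (mul_le_mul_of_nonneg_left hst (Nat.cast_nonneg n))

include hβ in
theorem ae_scaleMix_pos (hε : 0 ≤ ε)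
    (hσ : ∀ᵐ y ∂σ, y ∈ Set.Icc (0 : ℝ) 1) : ∀ᵐ r ∂scaleMix ε β σ, 0 < r := by
  refine ae_scaleMix measurableSet_Ioi ?_
  filter_upwards [hβ] with a ha
  filter_upwards [hσ] with y hy
  have := mul_nonneg hε hy.1
  positivity

include hβ in
theorem abs_williamson_scaleMix_sub_le [IsProbabilityMeasure β] [IsProbabilityMeasure σ] (n : ℕ)
    (hε : 0 ≤ ε) (hσ : ∀ᵐ y ∂σ, y ∈ Set.Icc (0 : ℝ) 1) {z : ℝ} (hz : 0 ≤ z) :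
    |williamson n (scaleMix ε β σ) z - williamson n β z| ≤ n * ε := by
  have hprob : IsProbabilityMeasure (scaleMix ε β σ) := ⟨by rw [scaleMix_univ, measure_univ]⟩
  have h1 : williamson n (scaleMix ε β σ) z
      = ∫ p, williamsonKernel n z (p.1 * (1 + ε * p.2)) ∂β.prod σ :=
    integral_map (measurable_scale ε).aemeasurable
      (measurable_williamsonKernel n z).aestronglyMeasurable
  have h2 : williamson n β z = ∫ p, williamsonKernel n z p.1 ∂β.prod σ := by
    rw [integral_fun_fst (μ := β) (ν := σ) (williamsonKernel n z)]
    simp [williamson]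
  have i1 : Integrable (fun p : ℝ × ℝ => williamsonKernel n z (p.1 * (1 + ε * p.2))) (β.prod σ) :=
    (integrable_map_measure (measurable_williamsonKernel n z).aestronglyMeasurable
      (measurable_scale ε).aemeasurable).1
      (integrable_williamsonKernel (ae_scaleMix_pos hβ hε hσ) n hz)
  have i2 : Integrable (fun p : ℝ × ℝ => williamsonKernel n z p.1) (β.prod σ) :=
    (integrable_williamsonKernel hβ n hz).comp_fst σ
  rw [h1, h2, ← integral_sub i1 i2]
  have hb : ∀ᵐ p ∂β.prod σ, ‖williamsonKernel n z (p.1 * (1 + ε * p.2)) - williamsonKernel n z p.1‖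
      ≤ n * ε := by
    have e1 : ∀ᵐ p ∂β.prod σ, 0 < p.1 := Measure.quasiMeasurePreserving_fst.ae hβ
    have e2 : ∀ᵐ p ∂β.prod σ, p.2 ∈ Set.Icc (0 : ℝ) 1 := Measure.quasiMeasurePreserving_snd.ae hσ
    filter_upwards [e1, e2] with p hp hp'
    exact abs_williamsonKernel_scale_sub_le n hz hp hε hp'
  simpa using norm_integral_le_of_norm_le_const hb

end scaleMix

/-! ### Williamson measures with prescribed Lebesgue parts -/

/-- `γa`, `γd`, `γs` are absolutely continuous, discrete, and singular without point masses. -/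
structure LebesgueParts (γa γd γs : Measure ℝ) : Prop where
  absolutelyContinuous : γa ≪ volume
  countable : ∃ D : Set ℝ, D.Countable ∧ γd Dᶜ = 0
  null : ∃ N : Set ℝ, MeasurableSet N ∧ volume N = 0 ∧ γs Nᶜ = 0
  singleton : ∀ x, γs {x} = 0

/-- `γ` charges every open set that meets `(0, ∞)`. -/
def ChargesPositive (γ : Measure ℝ) : Prop :=
  ∀ U : Set ℝ, IsOpen U → (U ∩ Set.Ioi 0).Nonempty → 0 < γ U

theorem ChargesPositive.mono {γ γ' : Measure ℝ} (h : ChargesPositive γ) (hle : γ ≤ γ') :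
    ChargesPositive γ' := fun U hU hU0 => (h U hU hU0).trans_le (hle U)

theorem williamson_convexCombination {α ν : Measure ℝ} [IsProbabilityMeasure α]
    [IsProbabilityMeasure ν] (hα : ∀ᵐ r ∂α, 0 < r) (hν : ∀ᵐ r ∂ν, 0 < r) (n : ℕ) {z : ℝ}
    (hz : 0 ≤ z) {e : ℝ≥0} (he : e ≤ 1) :
    |williamson n ((1 - e) • α + e • ν) z - williamson n α z| ≤ e := by
  have ia := integrable_williamsonKernel hα n hz
  have iv := integrable_williamsonKernel hν n hz
  have h1 : williamson n ((1 - e) • α + e • ν) z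
      = (1 - e) * williamson n α z + e * williamson n ν z := by
    unfold williamson
    rw [integral_add_measure (ia.smul_measure_nnreal) (iv.smul_measure_nnreal),
      integral_smul_nnreal_measure, integral_smul_nnreal_measure, NNReal.smul_def, NNReal.smul_def,
      NNReal.coe_sub he]
    simp
  rw [h1]
  have e0 : (0 : ℝ) ≤ e := e.2
  have b1 := williamson_le_one hα n hz
  have b2 := williamson_le_one hν n hz
  have b3 := williamson_nonneg (γ := α) n z
  have b4 := williamson_nonneg (γ := ν) n z
  rw [abs_le]
  constructor <;> nlinarith

/-- Mixing in the charging measure `ν` changes the transform by at most `e`, the random factor `1 +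
e Y` by at most `n e`. The three parts differ only in the law of `Y`, and `β` stays discrete, as the
singular part requires. -/
theorem exists_lebesgueParts_near {α : Measure ℝ} [IsProbabilityMeasure α]
    (hα : ∀ᵐ r ∂α, 0 < r) (hαD : ∃ D : Set ℝ, D.Countable ∧ α Dᶜ = 0) (n : ℕ) {δ : ℝ}
    (hδ : 0 < δ) {ca cd cs : ℝ≥0} (hc : ca + cd + cs = 1) :
    ∃ γa γd γs : Measure ℝ, LebesgueParts γa γd γs ∧
      IsProbabilityMeasure (γa + γd + γs) ∧ (∀ᵐ r ∂(γa + γd + γs), 0 < r) ∧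
      (γa Set.univ = ca ∧ γd Set.univ = cd ∧ γs Set.univ = cs) ∧
      (ca ≠ 0 → ChargesPositive γa) ∧ (cd ≠ 0 → ChargesPositive γd) ∧
      (cs ≠ 0 → ChargesPositive γs) ∧
      ∀ z, 0 ≤ z → |williamson n (γa + γd + γs) z - williamson n α z| ≤ δ := by
  obtain ⟨ν, hνp, hν, ⟨E, hE, hE0⟩, hνU⟩ := exists_discrete_charging
  obtain ⟨τ, N, hτp, hτ, hNm, hN0, hτN, hτI⟩ := exists_nullSingletonClass_singular
  obtain ⟨e, he0, he1, heδ⟩ : ∃ e : ℝ≥0, 0 < e ∧ e ≤ 1 ∧ (n : ℝ) * e + e ≤ δ := by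
    refine ⟨min 1 (Real.toNNReal (δ / (n + 1))), ?_, min_le_left _ _, ?_⟩
    · exact lt_min one_pos (Real.toNNReal_pos.2 (by positivity))
    · have h1 : ((min 1 (Real.toNNReal (δ / (n + 1))) : ℝ≥0) : ℝ) ≤ δ / (n + 1) := by
        exact (NNReal.coe_le_coe.2 (min_le_right _ _)).trans
          (Real.coe_toNNReal _ (by positivity)).le
      have h2 := mul_le_mul_of_nonneg_left h1 (by positivity : (0 : ℝ) ≤ n + 1)
      rw [mul_div_cancel₀ _ (by positivity)] at h2
      linarith
  have hepos : (0 : ℝ) < e := he0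
  set β : Measure ℝ := (1 - e) • α + e • ν with hβ
  have hβp : IsProbabilityMeasure β := by
    constructor
    simp only [hβ, Measure.add_apply, Measure.smul_apply, measure_univ, ENNReal.smul_def,
      smul_eq_mul, mul_one]
    rw [← ENNReal.coe_add, tsub_add_cancel_of_le he1, ENNReal.coe_one]
  have hβae : ∀ p : ℝ → Prop, (∀ᵐ r ∂α, p r) → (∀ᵐ r ∂ν, p r) → ∀ᵐ r ∂β, p r :=
    fun p h1 h2 => ae_add_measure_iff.2
      ⟨Measure.ae_smul_measure h1 (1 - e), Measure.ae_smul_measure h2 e⟩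
  have hβpos : ∀ᵐ r ∂β, 0 < r := hβae _ hα hν
  have hβD : ∃ D : Set ℝ, D.Countable ∧ β Dᶜ = 0 := by
    obtain ⟨D, hD, hD0⟩ := hαD
    refine ⟨D ∪ E, hD.union hE, hβae (fun r => r ∈ D ∪ E) ?_ ?_⟩
    · filter_upwards [show ∀ᵐ r ∂α, r ∈ D from hD0] with r hr using Or.inl hr
    · filter_upwards [show ∀ᵐ r ∂ν, r ∈ E from hE0] with r hr using Or.inr hr
  have hβU : ∀ U : Set ℝ, IsOpen U → (U ∩ Set.Ioi 0).Nonempty → 0 < β U := by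
    intro U hU hU0
    have h1 : 0 < (e : ℝ≥0∞) * ν U :=
      ENNReal.mul_pos (ENNReal.coe_ne_zero.2 he0.ne') (hνU U hU hU0).ne'
    refine h1.trans_le ?_
    rw [hβ, Measure.add_apply, Measure.smul_apply, Measure.smul_apply, ENNReal.smul_def,
      ENNReal.smul_def, smul_eq_mul, smul_eq_mul]
    exact le_add_self
  have hUp : IsProbabilityMeasure (volume.restrict (Set.Icc (0 : ℝ) 1)) := ⟨by simp⟩
  set σa : Measure ℝ := ca • volume.restrict (Set.Icc (0 : ℝ) 1) with hσa
  -- `Y = 0` leaves the radius unchanged, so this part is just a multiple of the discrete measure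
  -- `β`.
  set σd : Measure ℝ := cd • Measure.dirac (0 : ℝ) with hσd
  set σs : Measure ℝ := cs • τ with hσs
  have ma : σa Set.univ = ca := by
    rw [hσa, Measure.smul_apply, measure_univ, ENNReal.smul_def, smul_eq_mul, mul_one]
  have md : σd Set.univ = cd := by
    rw [hσd, Measure.smul_apply, measure_univ, ENNReal.smul_def, smul_eq_mul, mul_one]
  have ms : σs Set.univ = cs := by
    rw [hσs, Measure.smul_apply, measure_univ, ENNReal.smul_def, smul_eq_mul, mul_one]
  have Ia : ∀ᵐ y ∂σa, y ∈ Set.Icc (0 : ℝ) 1 :=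
    Measure.ae_smul_measure (ae_restrict_mem measurableSet_Icc) ca
  have Id : ∀ᵐ y ∂σd, y ∈ Set.Icc (0 : ℝ) 1 :=
    Measure.ae_smul_measure ((ae_dirac_iff (p := fun y => y ∈ Set.Icc (0 : ℝ) 1)
      measurableSet_Icc).2 ⟨le_rfl, zero_le_one⟩) cd
  have Is : ∀ᵐ y ∂σs, y ∈ Set.Icc (0 : ℝ) 1 := Measure.ae_smul_measure hτI cs
  have ne0 : ∀ {c : ℝ≥0} {σ : Measure ℝ}, σ Set.univ = c → c ≠ 0 → σ ≠ 0 := by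
    rintro c σ h hc rfl
    simp only [Measure.coe_zero, Pi.zero_apply] at h
    exact hc (ENNReal.coe_eq_zero.1 h.symm)
  have hsum : scaleMix e β σa + scaleMix e β σd + scaleMix e β σs
      = scaleMix e β (σa + σd + σs) := by rw [scaleMix_add, scaleMix_add]
  have hσp : IsProbabilityMeasure (σa + σd + σs) := by
    constructor
    rw [Measure.add_apply, Measure.add_apply, ma, md, ms]
    exact_mod_cast hc
  have hσI : ∀ᵐ y ∂(σa + σd + σs), y ∈ Set.Icc (0 : ℝ) 1 :=
    ae_add_measure_iff.2 ⟨ae_add_measure_iff.2 ⟨Ia, Id⟩, Is⟩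
  have hτs : NullSingletonClass σs := ⟨fun x => by simp [hσs]⟩
  have := nullSingletonClass_scaleMix (σ := σs) hβpos hepos.ne'
  refine ⟨scaleMix e β σa, scaleMix e β σd, scaleMix e β σs, ⟨?_, ?_, ?_, ?_⟩, ?_, ?_,
    ⟨by rw [scaleMix_univ, ma], by rw [scaleMix_univ, md], by rw [scaleMix_univ, ms]⟩,
    fun h U => scaleMix_pos_of_isOpen hepos.le (ne0 ma h) Ia hβU,
    fun h U => scaleMix_pos_of_isOpen hepos.le (ne0 md h) Id hβU,
    fun h U => scaleMix_pos_of_isOpen hepos.le (ne0 ms h) Is hβU, fun z hz => ?_⟩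
  · exact scaleMix_absolutelyContinuous hβpos hepos.ne'
      (Measure.restrict_le_self.absolutelyContinuous.smul_left ca)
  · exact exists_countable_scaleMix hβD ⟨{0}, Set.countable_singleton 0, by simp [hσd]⟩
  · exact exists_null_scaleMix hβpos hepos.ne' hβD hNm hN0 (by simp [hσs, hτN])
  · exact fun x => measure_singleton x
  · rw [hsum]
    exact ⟨by rw [scaleMix_univ, measure_univ]⟩
  · rw [hsum]
    exact ae_scaleMix_pos hβpos hepos.le hσI
  · rw [hsum]
    have h1 := abs_williamson_scaleMix_sub_le hβpos n hepos.le hσI hz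
    have h2 := williamson_convexCombination hα hν n hz he1
    rw [← hβ] at h2
    rw [abs_le] at *
    constructor <;> linarith

/-! ### The generator given by a Williamson transform -/

section generator

variable {γ : Measure ℝ} [IsProbabilityMeasure γ] (hγ : ∀ᵐ r ∂γ, 0 < r) {n : ℕ}

theorem williamson_zero (n : ℕ) : williamson n γ 0 = 1 := by
  simp [williamson, williamsonKernel]

include hγ

theorem continuousOn_williamson (n : ℕ) : ContinuousOn (williamson n γ) (Set.Ici 0) :=
  continuousOn_of_dominated (bound := fun _ => 1)
    (fun z _ => (measurable_williamsonKernel n z).aestronglyMeasurable)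
    (fun _ hz => norm_williamsonKernel_le hγ n hz) (integrable_const _)
    (ae_of_all _ fun r => (continuous_williamsonKernel n r).continuousOn)

theorem tendsto_williamson (hn : n ≠ 0) : Tendsto (williamson n γ) atTop (𝓝 0) := by
  have := tendsto_integral_filter_of_dominated_convergence (μ := γ) (l := atTop)
    (F := fun z r => williamsonKernel n z r) (f := fun _ => 0) (fun _ => 1)
    (Eventually.of_forall fun z => (measurable_williamsonKernel n z).aestronglyMeasurable)
    ((eventually_ge_atTop 0).mono fun z hz => norm_williamsonKernel_le hγ n hz)
    (integrable_const _) (by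
      filter_upwards [hγ] with r hr
      refine tendsto_const_nhds.congr' ?_
      filter_upwards [eventually_ge_atTop r] with z hz
      unfold williamsonKernel
      rw [max_eq_left, zero_pow hn]
      rw [sub_nonpos, one_le_div hr]
      exact hz)
  rwa [integral_zero] at this

/-- Every radius `r > z` contributes a strict decrease between `z` and `z'`, and `(z, ∞)` has
positive mass. In particular the transform never reaches `0`. -/
theorem williamson_strictAntiOn (hn : n ≠ 0) (hU : ChargesPositive γ) :
    StrictAntiOn (williamson n γ) (Set.Ici 0) := by
  intro z hz z' hz' h
  have hz0 : (0 : ℝ) ≤ z := hz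
  rw [← sub_pos]
  unfold williamson
  rw [← integral_sub (integrable_williamsonKernel hγ n hz) (integrable_williamsonKernel hγ n hz'),
    integral_pos_iff_support_of_nonneg_ae]
  · refine (hU (Set.Ioi z) isOpen_Ioi ⟨z + 1, by simp, ?_⟩).trans_le (measure_mono ?_)
    · simp only [Set.mem_Ioi]; linarith
    · intro r hr
      have hr' : z < r := hr
      have hr0 : 0 < r := hz0.trans_lt hr'
      have h1 : 0 < 1 - z / r := by rw [sub_pos, div_lt_one hr0]; exact hr'
      have h2 : 1 - z' / r < 1 - z / r := by
        have := (div_lt_div_iff_of_pos_right hr0).2 h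
        linarith
      rw [Function.mem_support, sub_ne_zero]
      unfold williamsonKernel
      refine (pow_lt_pow_left₀ ?_ (le_max_left _ _) hn).ne'
      rw [max_eq_right h1.le]
      exact max_lt h1 h2
  · filter_upwards [hγ] with r hr
    exact sub_nonneg.2 (williamsonKernel_antitone n hr h.le)
  · exact (integrable_williamsonKernel hγ n hz).sub (integrable_williamsonKernel hγ n hz')

theorem williamson_pos (hn : n ≠ 0) (hU : ChargesPositive γ) {z : ℝ} (hz : 0 ≤ z) :
    0 < williamson n γ z :=
  (williamson_nonneg n (z + 1)).trans_lt
    (williamson_strictAntiOn hγ hn hU hz (Set.mem_Ici.2 (by linarith)) (by linarith))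

omit hγ in
/-- The Williamson transform with values in the unit interval, extended to the negative numbers by
`1` (the value is truncated at `1`, which has no effect for measures on `(0, ∞)`). -/
noncomputable def williamsonGenerator (n : ℕ) (γ : Measure ℝ) (z : ℝ) : unitInterval :=
  Set.projIcc 0 1 zero_le_one (williamson n γ (max z 0))

theorem coe_williamsonGenerator {z : ℝ} (hz : 0 ≤ z) :
    (williamsonGenerator n γ z : ℝ) = williamson n γ z := by
  rw [williamsonGenerator, max_eq_left hz, Set.projIcc_of_mem _
    ⟨williamson_nonneg n z, williamson_le_one hγ n hz⟩]

theorem continuous_williamsonGenerator : Continuous (williamsonGenerator n γ) :=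
  continuous_projIcc.comp ((continuousOn_williamson hγ n).comp_continuous (by fun_prop)
    fun z => le_max_right z 0)

theorem williamsonGenerator_pos (hn : n ≠ 0) (hU : ChargesPositive γ) {z : ℝ} (hz : 0 ≤ z) :
    0 < williamsonGenerator n γ z := by
  rw [← Subtype.coe_lt_coe, coe_williamsonGenerator hγ hz]
  exact williamson_pos hγ hn hU hz

theorem williamsonGenerator_strictAntiOn (hn : n ≠ 0) (hU : ChargesPositive γ) :
    StrictAntiOn (williamsonGenerator n γ) (Set.Ici 0) := by
  intro z hz z' hz' h
  rw [← Subtype.coe_lt_coe, coe_williamsonGenerator hγ hz, coe_williamsonGenerator hγ hz']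
  exact williamson_strictAntiOn hγ hn hU hz hz' h

theorem isGenerator_williamsonGenerator (hn : n ≠ 0) (hU : ChargesPositive γ) :
    IsGenerator fun z : ℝ≥0 => williamsonGenerator n γ z where
  antitone z z' h := (williamsonGenerator_strictAntiOn hγ hn hU).antitoneOn z.2 z'.2 h
  continuous := (continuous_williamsonGenerator hγ).comp NNReal.continuous_coe
  map_zero := by
    apply Subtype.ext
    rw [NNReal.coe_zero, coe_williamsonGenerator hγ le_rfl, williamson_zero]
    rfl
  tendsto_atTop := by
    rw [tendsto_subtype_rng]
    refine ((tendsto_williamson hγ hn).comp (NNReal.tendsto_coe_atTop.2 tendsto_id)).congr fun z => ?_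
    exact (coe_williamsonGenerator hγ z.2).symm
  strictAntiOn z _ z' _ h := williamsonGenerator_strictAntiOn hγ hn hU z.2 z'.2 h

end generator

/-! ### Simplices -/

/-- The simplex `{x ≥ 0 | ∑ x_i ≤ t}`. -/
def cornerSimplex (n : ℕ) (t : ℝ) : Set (Fin n → ℝ) := {x | (∀ i, 0 ≤ x i) ∧ ∑ i, x i ≤ t}

theorem measurableSet_prod_cornerSimplex (n : ℕ) :
    MeasurableSet {p : (Fin n → ℝ) × ℝ | p.1 ∈ cornerSimplex n p.2} := by
  have : {p : (Fin n → ℝ) × ℝ | p.1 ∈ cornerSimplex n p.2}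
      = (⋂ i, {p | 0 ≤ p.1 i}) ∩ {p | ∑ i, p.1 i ≤ p.2} := by
    ext p; simp [cornerSimplex]
  rw [this]
  exact (MeasurableSet.iInter fun i => measurableSet_le (by fun_prop) (by fun_prop)).inter
    (measurableSet_le (by fun_prop) (by fun_prop))

open scoped Pointwise in
-- For `t > 0` this is scaling. For `t ≤ 0` the simplex is contained in the origin, which is null
-- because `n ≠ 0`. The constant is never evaluated, since it cancels later; it only has to be
-- finite and nonzero.
theorem volume_cornerSimplex {n : ℕ} (hn : n ≠ 0) (t : ℝ) :
    volume (cornerSimplex n t) = ENNReal.ofReal t ^ n * volume (cornerSimplex n 1) := by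
  rcases lt_or_ge 0 t with ht | ht
  · have : cornerSimplex n t = t • cornerSimplex n 1 := by
      ext x
      rw [Set.mem_smul_set_iff_inv_smul_mem₀ ht.ne']
      simp only [cornerSimplex, Set.mem_ofPred_eq, Pi.smul_apply, smul_eq_mul]
      rw [← Finset.mul_sum, inv_mul_le_one₀ ht]
      simp only [inv_pos.2 ht, mul_nonneg_iff_of_pos_left]
    rw [this, Measure.addHaar_smul, Module.finrank_fin_fun, abs_of_pos (pow_pos ht n),
      ENNReal.ofReal_pow ht.le]
  · have : NeZero n := ⟨hn⟩
    have hsub : cornerSimplex n t ⊆ {0} := by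
      rintro x ⟨hx, hx'⟩
      have h0 : ∑ i, x i = 0 := le_antisymm (hx'.trans ht) (Finset.sum_nonneg fun i _ => hx i)
      exact funext fun i => (Finset.sum_eq_zero_iff_of_nonneg fun i _ => hx i).1 h0 i
        (Finset.mem_univ i)
    have : Nonempty (Fin n) := ⟨0⟩
    rw [measure_mono_null hsub (measure_singleton 0), ENNReal.ofReal_of_nonpos ht, zero_pow hn,
      zero_mul]

theorem volume_cornerSimplex_ne_zero (n : ℕ) : volume (cornerSimplex n 1) ≠ 0 := by
  have hsub : Set.pi Set.univ (fun _ : Fin n => Set.Icc (0 : ℝ) (1 / (n + 1)))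
      ⊆ cornerSimplex n 1 := by
    intro x hx
    refine ⟨fun i => (hx i (Set.mem_univ i)).1, ?_⟩
    refine (Finset.sum_le_sum fun i _ => (hx i (Set.mem_univ i)).2).trans ?_
    rw [Finset.sum_const, Finset.card_univ, Fintype.card_fin, nsmul_eq_mul, mul_one_div,
      div_le_one (by positivity)]
    linarith
  refine ((measure_mono hsub).trans_lt' ?_).ne'
  rw [volume_pi_pi]
  refine pos_iff_ne_zero.2 (Finset.prod_ne_zero_iff.2 fun i _ => ?_)
  rw [Real.volume_Icc, sub_zero]
  exact (ENNReal.ofReal_pos.2 (by positivity)).ne'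

theorem volume_cornerSimplex_ne_top (n : ℕ) : volume (cornerSimplex n 1) ≠ ∞ := by
  have hsub : cornerSimplex n 1 ⊆ Set.Icc 0 1 := by
    rintro x ⟨hx, hx'⟩
    refine ⟨hx, fun i => ?_⟩
    exact (Finset.single_le_sum (fun j _ => hx j) (Finset.mem_univ i)).trans hx'
  exact ((measure_mono hsub).trans_lt isCompact_Icc.measure_lt_top).ne

/-! ### `ℓ¹`-symmetric laws -/

/-- The density of the uniform distribution on `cornerSimplex n r`. -/
noncomputable def simplexDensity (n : ℕ) (x : Fin n → ℝ) (r : ℝ) : ℝ≥0∞ :=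
  {p : (Fin n → ℝ) × ℝ | p.1 ∈ cornerSimplex n p.2}.indicator
    (fun p => (volume (cornerSimplex n 1) * ENNReal.ofReal p.2 ^ n)⁻¹) (x, r)

theorem measurable_simplexDensity (n : ℕ) :
    Measurable fun p : (Fin n → ℝ) × ℝ => simplexDensity n p.1 p.2 :=
  (by fun_prop : Measurable fun p : (Fin n → ℝ) × ℝ =>
    (volume (cornerSimplex n 1) * ENNReal.ofReal p.2 ^ n)⁻¹).indicator
    (measurableSet_prod_cornerSimplex n)

theorem simplexDensity_of_mem {n : ℕ} {x : Fin n → ℝ} {r : ℝ} (h : x ∈ cornerSimplex n r) :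
    simplexDensity n x r = (volume (cornerSimplex n 1) * ENNReal.ofReal r ^ n)⁻¹ :=
  Set.indicator_of_mem (s := {p : (Fin n → ℝ) × ℝ | p.1 ∈ cornerSimplex n p.2}) h _

theorem simplexDensity_of_notMem {n : ℕ} {x : Fin n → ℝ} {r : ℝ} (h : x ∉ cornerSimplex n r) :
    simplexDensity n x r = 0 :=
  Set.indicator_of_notMem (s := {p : (Fin n → ℝ) × ℝ | p.1 ∈ cornerSimplex n p.2}) h _

theorem simplexDensity_ne_zero {n : ℕ} {x : Fin n → ℝ} {r : ℝ} (h : x ∈ cornerSimplex n r) :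
    simplexDensity n x r ≠ 0 := by
  rw [simplexDensity_of_mem h]
  exact ENNReal.inv_ne_zero.2 (ENNReal.mul_ne_top (volume_cornerSimplex_ne_top n)
    (ENNReal.pow_ne_top ENNReal.ofReal_ne_top))

/-- The joint law of `(X₁, …, X_n)` and `R`, where `R` has law `g` and `(X₁, …, X_n)` is uniformly
distributed on `cornerSimplex n R` given `R`. -/
noncomputable def radialLaw (n : ℕ) (g : Measure ℝ) : Measure ((Fin n → ℝ) × ℝ) :=
  (volume.prod g).withDensity fun p => simplexDensity n p.1 p.2

theorem ae_radialLaw_mem (n : ℕ) (g : Measure ℝ) :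
    ∀ᵐ p ∂radialLaw n g, p.1 ∈ cornerSimplex n p.2 := by
  rw [radialLaw, ae_withDensity_iff (measurable_simplexDensity n)]
  refine ae_of_all _ fun p hp => ?_
  by_contra h
  exact hp (simplexDensity_of_notMem h)

theorem radialLaw_absolutelyContinuous (n : ℕ) (g : Measure ℝ) :
    radialLaw n g ≪ volume.prod g := withDensity_absolutelyContinuous _ _

/-- The density is nonzero at every point over the simplex. -/
theorem radialLaw_pos {n : ℕ} {g : Measure ℝ} {s : Set ((Fin n → ℝ) × ℝ)}
    (hs : ∀ p ∈ s, p.1 ∈ cornerSimplex n p.2) (h : 0 < (volume.prod g) s) :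
    0 < radialLaw n g s := by
  rw [pos_iff_ne_zero] at h ⊢
  intro h0
  refine h ?_
  rw [radialLaw, withDensity_apply_eq_zero' (measurable_simplexDensity n).aemeasurable] at h0
  refine measure_mono_null (fun p hp => ?_) h0
  exact ⟨simplexDensity_ne_zero (hs p hp), hp⟩

/-- For fixed `r` the admissible `x` form the simplex of size `r - (∑ z + w)` translated by `z`. Its
volume relative to the simplex of size `r` is the Williamson kernel, the positive part covering the
degenerate case. -/
theorem radialLaw_survival {n : ℕ} (hn : n ≠ 0) {g : Measure ℝ} [SFinite g]
    (hg : ∀ᵐ r ∂g, 0 < r) {z : Fin n → ℝ} (hz : ∀ i, 0 ≤ z i) {w : ℝ} (hw : 0 ≤ w) :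
    radialLaw n g {p | (∀ i, z i ≤ p.1 i) ∧ w ≤ p.2 - ∑ i, p.1 i}
      = ∫⁻ r, ENNReal.ofReal (williamsonKernel n (∑ i, z i + w) r) ∂g := by
  set S : Set ((Fin n → ℝ) × ℝ) := {p | (∀ i, z i ≤ p.1 i) ∧ w ≤ p.2 - ∑ i, p.1 i} with hS
  have hSm : MeasurableSet S := by
    have : S = (⋂ i, {p | z i ≤ p.1 i}) ∩ {p | w ≤ p.2 - ∑ i, p.1 i} := by
      ext p; simp [hS]
    rw [this]
    exact (MeasurableSet.iInter fun i => measurableSet_le (by fun_prop) (by fun_prop)).inter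
      (measurableSet_le (by fun_prop) (by fun_prop))
  rw [radialLaw, withDensity_apply _ hSm, ← lintegral_indicator hSm,
    lintegral_prod_symm _ ((measurable_simplexDensity n).indicator hSm).aemeasurable]
  refine lintegral_congr_ae ?_
  filter_upwards [hg] with r hr
  set c := volume (cornerSimplex n 1) with hc
  have hc0 : c ≠ 0 := volume_cornerSimplex_ne_zero n
  have hct : c ≠ ∞ := volume_cornerSimplex_ne_top n
  have hin : ∀ x : Fin n → ℝ, S.indicator (fun p => simplexDensity n p.1 p.2) (x, r)
      = ((fun x => x - z) ⁻¹' cornerSimplex n (r - (∑ i, z i + w))).indicator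
        (fun _ => (c * ENNReal.ofReal r ^ n)⁻¹) x := by
    intro x
    have hiff : (x, r) ∈ S ↔ x ∈ (fun x => x - z) ⁻¹' cornerSimplex n (r - (∑ i, z i + w)) := by
      simp only [hS, Set.mem_ofPred_eq, Set.mem_preimage, cornerSimplex, Pi.sub_apply, sub_nonneg,
        Finset.sum_sub_distrib]
      refine and_congr_right fun _ => ⟨fun h => by linarith, fun h => by linarith⟩
    by_cases hx : (x, r) ∈ S
    · rw [Set.indicator_of_mem hx, Set.indicator_of_mem (hiff.1 hx), simplexDensity_of_mem]
      refine ⟨fun i => (hz i).trans (hx.1 i), ?_⟩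
      have := hx.2
      simp only at this
      linarith
    · rw [Set.indicator_of_notMem hx, Set.indicator_of_notMem fun h => hx (hiff.2 h)]
  simp_rw [hin]
  have hm : MeasurableSet (cornerSimplex n (r - (∑ i, z i + w))) :=
    measurable_prodMk_right (measurableSet_prod_cornerSimplex n)
  rw [lintegral_indicator_const ((measurable_sub_const z) hm),
    (measurePreserving_sub_right volume z).measure_preimage hm.nullMeasurableSet, volume_cornerSimplex hn, ← hc]
  have h1 : 1 - (∑ i, z i + w) / r = (r - (∑ i, z i + w)) / r := by field_simp
  unfold williamsonKernel
  rw [ENNReal.ofReal_pow (le_max_left _ _), ENNReal.ofReal_max, ENNReal.ofReal_zero,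
    max_eq_right zero_le, h1, ENNReal.ofReal_div_of_pos hr, ENNReal.div_eq_inv_mul, mul_pow,
    ENNReal.mul_inv (Or.inl hc0) (Or.inl hct), ENNReal.inv_pow]
  calc c⁻¹ * (ENNReal.ofReal r)⁻¹ ^ n * (ENNReal.ofReal (r - (∑ i, z i + w)) ^ n * c)
      = (c⁻¹ * c) * ((ENNReal.ofReal r)⁻¹ ^ n * ENNReal.ofReal (r - (∑ i, z i + w)) ^ n) := by ring
    _ = _ := by rw [ENNReal.inv_mul_cancel hc0 hct, one_mul]

theorem radialLaw_univ {n : ℕ} (hn : n ≠ 0) {g : Measure ℝ} [SFinite g]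
    (hg : ∀ᵐ r ∂g, 0 < r) : radialLaw n g Set.univ = g Set.univ := by
  have h := radialLaw_survival hn hg (z := fun _ => 0) (fun _ => le_rfl) (w := 0) le_rfl
  have h1 : (∑ _i : Fin n, (0 : ℝ)) + 0 = 0 := by simp
  rw [h1] at h
  have h2 : ∀ r, williamsonKernel n 0 r = 1 := fun r => by simp [williamsonKernel]
  simp only [h2, ENNReal.ofReal_one, lintegral_one] at h
  rw [← h]
  refine measure_congr ?_
  filter_upwards [ae_radialLaw_mem n g] with p hp
  refine propext ⟨fun _ => ⟨hp.1, sub_nonneg.2 hp.2⟩, fun _ => trivial⟩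

theorem isProbabilityMeasure_radialLaw {n : ℕ} (hn : n ≠ 0) {g : Measure ℝ} [IsProbabilityMeasure g]
    (hg : ∀ᵐ r ∂g, 0 < r) : IsProbabilityMeasure (radialLaw n g) :=
  ⟨by rw [radialLaw_univ hn hg, measure_univ]⟩

/-! ### The Archimedean copula with a given Williamson measure -/

/-- The map `(x, r) ↦ (ψ(x₁), …, ψ(x_n), ψ(r - ∑ x_i))`. -/
noncomputable def radialMap (n : ℕ) (ψ : ℝ → unitInterval) (p : (Fin n → ℝ) × ℝ) : Cube (n + 1) :=
  joinCoords (fun i => ψ (p.1 i), ψ (p.2 - ∑ i, p.1 i))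

theorem radialMap_castSucc {n : ℕ} (ψ : ℝ → unitInterval) (p : (Fin n → ℝ) × ℝ) (i : Fin n) :
    radialMap n ψ p i.castSucc = ψ (p.1 i) := by simp [radialMap, joinCoords]

theorem radialMap_last {n : ℕ} (ψ : ℝ → unitInterval) (p : (Fin n → ℝ) × ℝ) :
    radialMap n ψ p (Fin.last n) = ψ (p.2 - ∑ i, p.1 i) := by simp [radialMap, joinCoords]

theorem firstCoords_radialMap {n : ℕ} (ψ : ℝ → unitInterval) (p : (Fin n → ℝ) × ℝ) :
    firstCoords (radialMap n ψ p) = fun i => ψ (p.1 i) :=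
  funext fun i => radialMap_castSucc ψ p i

theorem lastCoord_radialMap {n : ℕ} (ψ : ℝ → unitInterval) (p : (Fin n → ℝ) × ℝ) :
    lastCoord (radialMap n ψ p) = ψ (p.2 - ∑ i, p.1 i) := radialMap_last ψ p

theorem continuous_radialMap {n : ℕ} {ψ : ℝ → unitInterval} (hψ : Continuous ψ) :
    Continuous (radialMap n ψ) := by
  refine continuous_pi fun i => ?_
  refine Fin.lastCases ?_ (fun j => ?_) i
  · simp only [radialMap_last]; fun_prop
  · simp only [radialMap_castSucc]; fun_prop

section copula

variable {γ : Measure ℝ} [IsProbabilityMeasure γ] (hγ : ∀ᵐ r ∂γ, 0 < r) {n : ℕ} (hn : n ≠ 0)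
  (hU : ChargesPositive γ)
include hγ hn hU

theorem williamsonGenerator_le_iff {x z : ℝ} (hx : 0 ≤ x) (hz : 0 ≤ z) :
    williamsonGenerator n γ x ≤ williamsonGenerator n γ z ↔ z ≤ x :=
  (williamsonGenerator_strictAntiOn hγ hn hU).le_iff_ge hx hz

/-- As `ψ` is strictly decreasing on `[0, ∞)`, lower orthants at `ψ(z)` pull back to upper orthants
at `z`, up to a null set. -/
theorem map_radialMap_Iic (z : Fin (n + 1) → ℝ≥0) :
    (radialLaw n γ).map (radialMap n (williamsonGenerator n γ))
      (Set.Iic fun i => williamsonGenerator n γ (z i))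
      = ENNReal.ofReal (williamsonGenerator n γ (∑ i, z i : ℝ≥0)) := by
  rw [Measure.map_apply (continuous_radialMap (continuous_williamsonGenerator hγ)).measurable
    measurableSet_Iic, coe_williamsonGenerator hγ (NNReal.coe_nonneg _),
    ofReal_williamson hγ n (NNReal.coe_nonneg _)]
  have h := radialLaw_survival hn hγ (z := fun i => (z i.castSucc : ℝ)) (fun i => (z _).2)
    (w := z (Fin.last n)) (z _).2
  rw [Fin.sum_univ_castSucc, NNReal.coe_add, NNReal.coe_sum, ← h]
  refine measure_congr ?_
  filter_upwards [ae_radialLaw_mem n γ] with p hp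
  refine propext ?_
  change (radialMap n (williamsonGenerator n γ) p ≤ _) ↔
    (∀ i, (z (Fin.castSucc i) : ℝ) ≤ p.1 i) ∧ (z (Fin.last n) : ℝ) ≤ p.2 - ∑ i, p.1 i
  rw [Pi.le_def, Fin.forall_fin_succ']
  simp only [radialMap_castSucc, radialMap_last]
  rw [williamsonGenerator_le_iff hγ hn hU (sub_nonneg.2 hp.2) (NNReal.coe_nonneg (z _))]
  refine and_congr_left fun _ => forall_congr' fun i => ?_
  rw [williamsonGenerator_le_iff hγ hn hU (hp.1 i) (NNReal.coe_nonneg (z _))]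

theorem map_radialMap_Iic_of_eq_zero {u : Cube (n + 1)} {i : Fin (n + 1)} (hu : u i = 0) :
    (radialLaw n γ).map (radialMap n (williamsonGenerator n γ)) (Set.Iic u) = 0 := by
  rw [Measure.map_apply (continuous_radialMap (continuous_williamsonGenerator hγ)).measurable
    measurableSet_Iic]
  have : ∀ᵐ p ∂radialLaw n γ, p ∉ radialMap n (williamsonGenerator n γ) ⁻¹' Set.Iic u := by
    filter_upwards [ae_radialLaw_mem n γ] with p hp hp'
    have h := hp' i
    rw [hu] at h
    refine absurd h (not_le.2 ?_)
    refine Fin.lastCases ?_ (fun j => ?_) i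
    · rw [radialMap_last]
      exact williamsonGenerator_pos hγ hn hU (sub_nonneg.2 hp.2)
    · rw [radialMap_castSucc]
      exact williamsonGenerator_pos hγ hn hU (hp.1 j)
  exact measure_eq_zero_iff_ae_notMem.2 this

theorem map_radialMap_eval (i : Fin (n + 1)) :
    ((radialLaw n γ).map (radialMap n (williamsonGenerator n γ))).map (fun u => u i) = volume := by
  have hm := (continuous_radialMap (n := n) (continuous_williamsonGenerator hγ (n := n))).measurable
  have := isProbabilityMeasure_radialLaw hn hγ
  have := Measure.isProbabilityMeasure_map (μ := radialLaw n γ) hm.aemeasurable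
  have := Measure.isProbabilityMeasure_map
    (μ := (radialLaw n γ).map (radialMap n (williamsonGenerator n γ)))
    (measurable_pi_apply i).aemeasurable
  refine Measure.ext_of_Iic _ _ fun v => ?_
  rw [Measure.map_apply (measurable_pi_apply i) measurableSet_Iic, unitInterval.volume_Iic]
  have hset : ∀ u : Cube (n + 1), u = Function.update (fun _ => 1) i v →
      (fun w : Cube (n + 1) => w i) ⁻¹' Set.Iic v = Set.Iic u := by
    rintro u rfl
    ext w
    simp only [Set.mem_preimage, Set.mem_Iic, Pi.le_def]
    refine ⟨fun h j => ?_, fun h => by simpa using h i⟩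
    by_cases hj : j = i
    · subst hj; simpa using h
    · simpa [hj] using unitInterval.le_one'
  rcases eq_or_lt_of_le (unitInterval.nonneg' (t := v)) with h0 | h0
  · rw [hset _ rfl, map_radialMap_Iic_of_eq_zero hγ hn hU (i := i) (by simp [← h0]), ← h0]
    simp
  · have hg := isGenerator_williamsonGenerator hγ hn hU
    obtain ⟨a, ha⟩ := hg.exists_eq h0
    -- The unconstrained coordinates equal `1 = ψ 0`, so the only nonzero term of the sum is `a`,
    -- and the mass is `ψ a = v`.
    have hz : (fun j => williamsonGenerator n γ ((Pi.single i a : Fin (n + 1) → ℝ≥0) j))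
        = Function.update (fun _ => 1) i v := by
      funext j
      by_cases hj : j = i
      · subst hj; simpa using ha
      · simpa [hj] using hg.map_zero
    rw [hset _ hz, map_radialMap_Iic hγ hn hU, Finset.sum_pi_single']
    simp only [Finset.mem_univ, if_true]
    rw [← ha]

theorem exists_archimedean_of_williamson : ∃ C : Copula (n + 1),
    C.measure = (radialLaw n γ).map (radialMap n (williamsonGenerator n γ)) ∧
    ∀ x, C x = (extendTop (fun z : ℝ≥0 => williamsonGenerator n γ z)
      (∑ i, pseudoInverse (fun z : ℝ≥0 => williamsonGenerator n γ z) (x i)) : ℝ) := by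
  have hm := (continuous_radialMap (n := n) (continuous_williamsonGenerator hγ (n := n))).measurable
  have := isProbabilityMeasure_radialLaw hn hγ
  have hp := Measure.isProbabilityMeasure_map (μ := radialLaw n γ) hm.aemeasurable
  have hg := isGenerator_williamsonGenerator hγ hn hU
  let C : Copula (n + 1) :=
    ⟨fun x => ((radialLaw n γ).map (radialMap n (williamsonGenerator n γ))).real (Set.Iic x),
      _, hp, map_radialMap_eval hγ hn hU, fun x => rfl⟩
  refine ⟨C, (C.eq_measure _ fun x => rfl).symm, fun u => ?_⟩
  by_cases hu : ∀ i, 0 < u i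
  · choose z hz using fun i => hg.exists_eq (hu i)
    obtain rfl : u = fun i => williamsonGenerator n γ (z i) := funext fun i => (hz i).symm
    have h1 : ∀ i, pseudoInverse (fun z : ℝ≥0 => williamsonGenerator n γ z)
        (williamsonGenerator n γ (z i)) = z i := fun i => hg.pseudoInverse_apply (hz i ▸ hu i)
    simp_rw [h1]
    rw [← ENNReal.ofNNReal_finsetSum, extendTop, if_neg ENNReal.coe_ne_top, ENNReal.toNNReal_coe]
    change (Measure.map _ _).real _ = _
    rw [Measure.real, map_radialMap_Iic hγ hn hU, ENNReal.toReal_ofReal]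
    exact unitInterval.nonneg _
  · push Not at hu
    obtain ⟨i, hi⟩ := hu
    have hi0 : u i = 0 := le_antisymm hi unitInterval.nonneg'
    rw [C.apply_eq_zero hi0]
    -- `ψ` is positive at every finite argument, so its extension takes the value `0` only at `∞`.
    have htop : pseudoInverse (fun z : ℝ≥0 => williamsonGenerator n γ z) (u i) = ∞ := by
      rw [hi0, pseudoInverse, sInf_eq_top]
      intro a ha
      by_contra hat
      rw [Set.mem_ofPred_eq, extendTop, if_neg hat] at ha
      exact (williamsonGenerator_pos hγ hn hU (NNReal.coe_nonneg _)).ne' ha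
    have hsum : ∑ i, pseudoInverse (fun z : ℝ≥0 => williamsonGenerator n γ z) (u i) = ∞ :=
      ENNReal.sum_eq_top.2 ⟨i, Finset.mem_univ i, htop⟩
    rw [hsum, extendTop, if_pos rfl]
    rfl

end copula

/-! ### The parts of a kernel with a known decomposition -/

section parts

variable {κ a d s : Measure unitInterval} [IsFiniteMeasure κ] (hκ : κ = a + d + s)
  (ha : a ≪ volume) (hd : ∃ D : Set unitInterval, D.Countable ∧ d Dᶜ = 0)
  (hs : ∃ N : Set unitInterval, MeasurableSet N ∧ volume N = 0 ∧ s Nᶜ = 0)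
  (hs' : ∀ v, s {v} = 0)

include hd hs in
theorem mutuallySingular_discrete_add_singular : d + s ⟂ₘ (volume : Measure unitInterval) := by
  obtain ⟨D, hD, hD0⟩ := hd
  obtain ⟨N, hN, hN0, hsN⟩ := hs
  refine Measure.MutuallySingular.add_left ⟨Dᶜ, hD.measurableSet.compl, hD0, ?_⟩
    ⟨Nᶜ, hN.compl, hsN, ?_⟩
  · rw [compl_compl]; exact hD.measure_zero _
  · rwa [compl_compl]

include hκ ha hd hs in
-- Uniqueness of the Lebesgue decomposition, `d + s` being carried by a null set.
theorem withDensity_rnDeriv_eq_of_parts : volume.withDensity (κ.rnDeriv volume) = a := by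
  have := isFiniteMeasure_of_le κ (show a ≤ κ by rw [hκ, add_assoc]; exact Measure.le_add_right le_rfl)
  rw [← Measure.eq_withDensity_rnDeriv (s := d + s) (f := a.rnDeriv volume)
    (Measure.measurable_rnDeriv _ _) (mutuallySingular_discrete_add_singular hd hs)]
  · exact Measure.withDensity_rnDeriv_eq _ _ ha
  · rw [Measure.withDensity_rnDeriv_eq _ _ ha, hκ]
    abel

include hκ ha hd hs in
theorem singularPart_eq_of_parts : κ.singularPart volume = d + s := by
  have := isFiniteMeasure_of_le κ (show a ≤ κ by rw [hκ, add_assoc]; exact Measure.le_add_right le_rfl)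
  rw [← Measure.eq_singularPart (s := d + s) (f := a.rnDeriv volume)
    (Measure.measurable_rnDeriv _ _) (mutuallySingular_discrete_add_singular hd hs)]
  rw [Measure.withDensity_rnDeriv_eq _ _ ha, hκ]
  abel

omit [IsFiniteMeasure κ] in
include hκ hd in
-- A point without `κ`-mass has no `d`-mass since `d ≤ κ`, and only the countably many points of `D`
-- matter.
theorem discrete_compl_pointMasses : d {v | κ {v} ≠ 0}ᶜ = 0 := by
  obtain ⟨D, hD, hD0⟩ := hd
  refine measure_mono_null (t := Dᶜ ∪ (D ∩ {v | κ {v} ≠ 0}ᶜ)) (fun v hv => ?_)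
    (measure_union_null hD0 ?_)
  · by_cases h : v ∈ D
    · exact Or.inr ⟨h, hv⟩
    · exact Or.inl h
  · have hc : (D ∩ {v | κ {v} ≠ 0}ᶜ).Countable := hD.mono Set.inter_subset_left
    rw [← Set.biUnion_of_singleton (D ∩ {v | κ {v} ≠ 0}ᶜ), measure_biUnion_null_iff hc]
    rintro v ⟨-, hv⟩
    have hv' : κ {v} = 0 := by simpa using hv
    rw [hκ, Measure.add_apply, Measure.add_apply] at hv'
    simp only [add_eq_zero] at hv'
    exact hv'.1.2

theorem countable_pointMasses (κ : Measure unitInterval) [IsFiniteMeasure κ] :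
    {v | κ {v} ≠ 0}.Countable :=
  (Measure.countable_meas_pos_of_disjoint_iUnion (μ := κ) (As := fun v => {v})
    (fun v => measurableSet_singleton v)
    (fun _ _ h => Set.disjoint_singleton.2 h)).mono fun _ hv => pos_iff_ne_zero.2 hv

include hκ ha hd hs' in
-- The atoms of `κ` form a countable set, which is null for both `a` and `s`.
theorem restrict_pointMasses_eq_of_parts : κ.restrict {v | κ {v} ≠ 0} = d := by
  have hc := countable_pointMasses κ
  have h1 : a.restrict {v | κ {v} ≠ 0} = 0 := by
    rw [Measure.restrict_eq_zero]; exact ha (hc.measure_zero _)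
  have h2 : s.restrict {v | κ {v} ≠ 0} = 0 := by
    have : NullSingletonClass s := ⟨hs'⟩
    rw [Measure.restrict_eq_zero]; exact hc.measure_zero _
  have h3 : d.restrict {v | κ {v} ≠ 0} = d :=
    Measure.restrict_eq_self_of_ae_mem (discrete_compl_pointMasses hκ hd)
  calc κ.restrict {v | κ {v} ≠ 0} = (a + d + s).restrict {v | κ {v} ≠ 0} := by rw [← hκ]
    _ = d := by rw [Measure.restrict_add, Measure.restrict_add, h1, h2, h3, zero_add, add_zero]

include hκ ha hd hs hs' in
theorem singularPart_restrict_eq_of_parts :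
    (κ.singularPart volume).restrict {v | κ {v} ≠ 0}ᶜ = s := by
  have hc := countable_pointMasses κ
  have h1 : d.restrict {v | κ {v} ≠ 0}ᶜ = 0 := by
    rw [Measure.restrict_eq_zero]; exact discrete_compl_pointMasses hκ hd
  have h2 : s.restrict {v | κ {v} ≠ 0}ᶜ = s := by
    have : NullSingletonClass s := ⟨hs'⟩
    refine Measure.restrict_eq_self_of_ae_mem ?_
    exact measure_eq_zero_iff_ae_notMem.1 (hc.measure_zero s)
  rw [singularPart_eq_of_parts hκ ha hd hs, Measure.restrict_add, h1, h2, zero_add]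

end parts

section kernelParts

variable {α : Type*} [MeasurableSpace α] (K : Kernel α unitInterval) [IsFiniteKernel K] (x : α)

theorem absPart_apply : absPart K x = volume.withDensity ((K x).rnDeriv volume) := by
  rw [absPart, Kernel.withDensity_apply _ (Kernel.measurable_rnDeriv _ _), Kernel.const_apply]
  exact withDensity_congr_ae
    (Kernel.rnDeriv_eq_rnDeriv_measure (κ := K) (η := Kernel.const α volume) (a := x))

theorem disPart_apply : disPart K x = (K x).restrict {v | K x {v} ≠ 0} := rfl

theorem singPart_apply :
    singPart K x = ((K x).singularPart volume).restrict {v | K x {v} ≠ 0}ᶜ := by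
  rw [← Kernel.const_apply (α := α) (volume : Measure unitInterval) x,
    ← Kernel.singularPart_eq_singularPart_measure]
  rfl

end kernelParts

namespace Copula

/-- The conditional distribution is almost everywhere unique, so the components can be read off any
kernel that disintegrates the law; fibrewise uniqueness of the decomposition identifies the three
parts. -/
theorem components_eq {n : ℕ} (C : Copula (n + 1)) {Ka Kd Ks : Kernel (Cube n) unitInterval}
    [IsFiniteKernel Ka] [IsFiniteKernel Kd] [IsFiniteKernel Ks]
    (h : C.measure.map (fun u => (firstCoords u, lastCoord u)) = C.marginal ⊗ₘ (Ka + Kd + Ks))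
    (ha : ∀ u, Ka u ≪ volume)
    (hd : ∀ u, ∃ D : Set unitInterval, D.Countable ∧ Kd u Dᶜ = 0)
    (hs : ∀ u, ∃ N : Set unitInterval, MeasurableSet N ∧ volume N = 0 ∧ Ks u Nᶜ = 0)
    (hs' : ∀ u v, Ks u {v} = 0) :
    C.absComponent = (C.marginal ⊗ₘ Ka).map joinCoords ∧
    C.disComponent = (C.marginal ⊗ₘ Kd).map joinCoords ∧
    C.singComponent = (C.marginal ⊗ₘ Ks).map joinCoords := by
  have hK : ∀ᵐ u ∂C.marginal, C.markovKernel u = Ka u + Kd u + Ks u :=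
    condDistrib_ae_eq_of_measure_eq_compProd firstCoords measurable_lastCoord.aemeasurable h
  refine ⟨?_, ?_, ?_⟩
  · rw [absComponent]
    congr 1
    refine Measure.compProd_congr ?_
    filter_upwards [hK] with u hu
    rw [absPart_apply, withDensity_rnDeriv_eq_of_parts hu (ha u) (hd u) (hs u)]
  · rw [disComponent]
    congr 1
    refine Measure.compProd_congr ?_
    filter_upwards [hK] with u hu
    rw [disPart_apply, restrict_pointMasses_eq_of_parts hu (ha u) (hd u) (hs' u)]
  · rw [singComponent]
    congr 1
    refine Measure.compProd_congr ?_
    filter_upwards [hK] with u hu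
    rw [singPart_apply, singularPart_restrict_eq_of_parts hu (ha u) (hd u) (hs u) (hs' u)]

end Copula

/-! ### Product measures -/

theorem pi_absolutelyContinuous {n : ℕ} {X : Type*} [MeasurableSpace X] (μ ν : Measure X)
    [SigmaFinite μ] [SigmaFinite ν] (h : μ ≪ ν) :
    Measure.pi (fun _ : Fin n => μ) ≪ Measure.pi (fun _ : Fin n => ν) := by
  induction n with
  | zero =>
    rw [Measure.pi_of_empty, Measure.pi_of_empty]
  | succ n ih =>
    have e1 := (measurePreserving_piFinSuccAbove (fun _ : Fin (n + 1) => μ) 0).symm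
    have e2 := (measurePreserving_piFinSuccAbove (fun _ : Fin (n + 1) => ν) 0).symm
    rw [← e1.map_eq, ← e2.map_eq]
    exact (h.prod ih).map (MeasurableEquiv.measurable _)

/-! ### Disintegration of `ℓ¹`-symmetric laws -/

/-- The density of the first component of `radialLaw n γ`. -/
noncomputable def radialDensity (n : ℕ) (γ : Measure ℝ) (x : Fin n → ℝ) : ℝ≥0∞ :=
  ∫⁻ r, simplexDensity n x r ∂γ

theorem measurable_radialDensity (n : ℕ) (γ : Measure ℝ) [SFinite γ] :
    Measurable (radialDensity n γ) := (measurable_simplexDensity n).lintegral_prod_right'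

theorem radialLaw_map_fst (n : ℕ) (γ : Measure ℝ) [SFinite γ] :
    (radialLaw n γ).map Prod.fst = volume.withDensity (radialDensity n γ) := by
  ext A hA
  rw [Measure.map_apply measurable_fst hA, radialLaw, withDensity_apply _ (measurable_fst hA),
    withDensity_apply _ hA, ← Set.prod_univ, ← Measure.prod_restrict, Measure.restrict_univ,
    lintegral_prod _ (measurable_simplexDensity n).aemeasurable]
  rfl

/-- The component of the conditional law of `R` given `X`, under `radialLaw n γ`, that stems from the
part `g` of `γ`. -/
noncomputable def radialKernel (n : ℕ) (γ g : Measure ℝ) [SFinite g] : Kernel (Fin n → ℝ) ℝ :=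
  Kernel.withDensity (Kernel.const _ g) fun x r => simplexDensity n x r / radialDensity n γ x

theorem measurable_conditionalDensity (n : ℕ) (γ : Measure ℝ) [SFinite γ] :
    Measurable (Function.uncurry fun (x : Fin n → ℝ) (r : ℝ) =>
      simplexDensity n x r / radialDensity n γ x) :=
  (measurable_simplexDensity n).div ((measurable_radialDensity n γ).comp measurable_fst)

section radialKernel

variable {n : ℕ} {γ g : Measure ℝ} [SFinite γ] [SFinite g]

theorem radialKernel_apply (x : Fin n → ℝ) : radialKernel n γ g x
    = g.withDensity fun r => simplexDensity n x r / radialDensity n γ x := by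
  rw [radialKernel, Kernel.withDensity_apply _ (measurable_conditionalDensity n γ),
    Kernel.const_apply]

theorem isFiniteKernel_radialKernel (hg : g ≤ γ) : IsFiniteKernel (radialKernel n γ g) := by
  refine ⟨1, ENNReal.one_lt_top, fun x => ?_⟩
  have hm : Measurable fun r => simplexDensity n x r :=
    (measurable_simplexDensity n).comp measurable_prodMk_left
  rw [radialKernel_apply, withDensity_apply _ MeasurableSet.univ, Measure.restrict_univ]
  refine (lintegral_mono' hg le_rfl).trans ?_
  simp_rw [div_eq_mul_inv]
  rw [lintegral_mul_const _ hm]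
  exact ENNReal.mul_inv_le_one _

theorem radialKernel_absolutelyContinuous (x : Fin n → ℝ) : radialKernel n γ g x ≪ g := by
  rw [radialKernel_apply]; exact withDensity_absolutelyContinuous _ _

theorem ae_radialKernel_le (x : Fin n → ℝ) : ∀ᵐ r ∂radialKernel n γ g x, ∑ i, x i ≤ r := by
  have hm : Measurable fun r => simplexDensity n x r / radialDensity n γ x :=
    (measurable_conditionalDensity n γ).comp measurable_prodMk_left
  rw [radialKernel_apply, ae_withDensity_iff hm]
  refine ae_of_all _ fun r hr => ?_
  by_contra h
  exact hr (by rw [simplexDensity_of_notMem fun hx => h hx.2, ENNReal.zero_div])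

/-- The normaliser is the marginal density of the whole `γ`, even when `g` is only a part of it. All
parts thus share one first marginal, and their kernels add up to the conditional law of `R`. -/
theorem radialLaw_eq_compProd [IsFiniteMeasure γ] (hn : n ≠ 0) (hγ : ∀ᵐ r ∂γ, 0 < r) (hg : g ≤ γ) :
    radialLaw n g = volume.withDensity (radialDensity n γ) ⊗ₘ radialKernel n γ g := by
  have hfin := isFiniteKernel_radialKernel (n := n) hg
  have hGm := measurable_radialDensity n γ
  have hGtop : ∀ᵐ x, radialDensity n γ x ≠ ∞ := by
    have h1 : (volume.withDensity (radialDensity n γ)) Set.univ = γ Set.univ := by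
      rw [← radialLaw_map_fst, Measure.map_apply measurable_fst MeasurableSet.univ,
        Set.preimage_univ, radialLaw_univ hn hγ]
    rw [withDensity_apply _ MeasurableSet.univ, Measure.restrict_univ] at h1
    filter_upwards [ae_lt_top hGm (h1 ▸ measure_ne_top γ _)] with x hx using hx.ne
  ext s hs
  rw [Measure.compProd_apply hs, lintegral_withDensity_eq_lintegral_mul _ hGm
    (Kernel.measurable_kernel_prodMk_left hs), radialLaw, withDensity_apply _ hs,
    ← lintegral_indicator hs,
    lintegral_prod _ ((measurable_simplexDensity n).indicator hs).aemeasurable]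
  refine lintegral_congr_ae ?_
  filter_upwards [hGtop] with x hx
  have hsx : MeasurableSet (Prod.mk x ⁻¹' s) := measurable_prodMk_left hs
  have hm : Measurable fun r => simplexDensity n x r :=
    (measurable_simplexDensity n).comp measurable_prodMk_left
  have h1 : ∫⁻ r, s.indicator (fun p => simplexDensity n p.1 p.2) (x, r) ∂g
      = ∫⁻ r in Prod.mk x ⁻¹' s, simplexDensity n x r ∂g := by
    rw [← lintegral_indicator hsx]; rfl
  rw [h1, Pi.mul_apply, radialKernel_apply, withDensity_apply _ hsx]
  simp_rw [div_eq_mul_inv]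
  rw [lintegral_mul_const _ hm]
  -- Where the marginal density vanishes, the simplex density is zero `γ`-a.e., hence `g`-a.e.
  -- because `g ≤ γ`.
  by_cases h0 : radialDensity n γ x = 0
  · rw [h0, zero_mul]
    have h2 : simplexDensity n x =ᵐ[γ] 0 := (lintegral_eq_zero_iff hm).1 h0
    refine lintegral_eq_zero_of_ae_eq_zero ?_
    exact ae_restrict_of_ae ((Measure.absolutelyContinuous_of_le hg).ae_le h2)
  · rw [mul_comm, mul_assoc, ENNReal.inv_mul_cancel h0 hx, mul_one]

end radialKernel

/-! ### The image of Lebesgue measure under the generator -/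

section generator

variable {γ : Measure ℝ} [IsProbabilityMeasure γ] (hγ : ∀ᵐ r ∂γ, 0 < r) {n : ℕ} (hn : n ≠ 0)
  (hU : ChargesPositive γ)

omit [IsProbabilityMeasure γ] in
theorem radialLaw_map_eval_absolutelyContinuous [SFinite γ] (i : Fin n) :
    (radialLaw n γ).map (fun p => p.1 i) ≪ volume := by
  have h1 : Measure.QuasiMeasurePreserving (fun p : (Fin n → ℝ) × ℝ => p.1 i)
      (volume.prod γ) volume :=
    (Measure.quasiMeasurePreserving_eval (fun _ : Fin n => (volume : Measure ℝ)) i).comp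
      Measure.quasiMeasurePreserving_fst
  exact ((radialLaw_absolutelyContinuous n γ).map h1.measurable).trans h1.absolutelyContinuous

include hU in
-- If `A ∩ [0, k + 1]` had positive length, the box with this `i`-th side and all others `[0, k +
-- 1]`, taken with radii above `n (k + 1)`, would lie over the simplex and have positive mass. Such
-- radii are charged by `γ`.
theorem restrict_absolutelyContinuous_radialLaw_map_eval (i : Fin n) :
    volume.restrict (Set.Ici 0) ≪ (radialLaw n γ).map (fun p => p.1 i) := by
  refine Measure.AbsolutelyContinuous.mk fun A hA h0 => ?_
  have hm : Measurable fun p : (Fin n → ℝ) × ℝ => p.1 i := by fun_prop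
  rw [Measure.map_apply hm hA] at h0
  rw [Measure.restrict_apply hA]
  have hcover : A ∩ Set.Ici 0 ⊆ ⋃ k : ℕ, A ∩ Set.Icc (0 : ℝ) (k + 1) := by
    rintro x ⟨hx, hx0⟩
    obtain ⟨k, hk⟩ := exists_nat_ge x
    exact Set.mem_iUnion.2 ⟨k, hx, hx0, by linarith⟩
  refine measure_mono_null hcover (measure_iUnion_null fun k => ?_)
  set t : Fin n → Set ℝ := Function.update (fun _ => Set.Icc (0 : ℝ) (k + 1)) i
    (A ∩ Set.Icc (0 : ℝ) (k + 1)) with ht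
  have htk : ∀ j, t j ⊆ Set.Icc (0 : ℝ) (k + 1) := by
    intro j
    by_cases hj : j = i
    · subst hj; simp [ht]
    · simp [ht, hj]
  by_contra hne
  have hpos : 0 < (volume.prod γ) (Set.pi Set.univ t ×ˢ Set.Ioi ((n : ℝ) * (k + 1))) := by
    rw [Measure.prod_prod, volume_pi_pi]
    refine ENNReal.mul_pos (Finset.prod_ne_zero_iff.2 fun j _ => ?_) (hU _ isOpen_Ioi ?_).ne'
    · by_cases hj : j = i
      · subst hj; simpa [ht] using hne
      · have : (0 : ℝ) < k + 1 := by positivity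
        simpa [ht, hj] using this
    · refine ⟨(n : ℝ) * (k + 1) + 1, ?_, ?_⟩
      · simp
      · simp only [Set.mem_Ioi]; positivity
  have hpos' := radialLaw_pos (n := n) (by
    rintro p ⟨hp, hp'⟩
    refine ⟨fun j => (htk j (hp j trivial)).1, ?_⟩
    refine (Finset.sum_le_sum fun j _ => (htk j (hp j trivial)).2).trans ?_
    simp only [Finset.sum_const, Finset.card_univ, Fintype.card_fin, nsmul_eq_mul]
    exact (Set.mem_Ioi.1 hp').le) hpos
  refine hpos'.ne' (measure_mono_null ?_ h0)
  rintro p ⟨hp, -⟩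
  have := hp i trivial
  rw [ht, Function.update_self] at this
  exact this.1

include hγ hn hU in
theorem map_generator_eval (i : Fin n) : ((radialLaw n γ).map (fun p => p.1 i)).map
    (williamsonGenerator n γ) = volume := by
  have hψ := continuous_williamsonGenerator hγ (n := n)
  rw [← map_radialMap_eval hγ hn hU i.castSucc, Measure.map_map hψ.measurable (by fun_prop),
    Measure.map_map (measurable_pi_apply _) (continuous_radialMap hψ).measurable]
  congr 1
  funext p
  exact (radialMap_castSucc _ p i).symm

include hγ hn hU in
-- No derivative of `ψ` is needed: `ψ(X_0)` is uniform, and Lebesgue measure on `[0, ∞)` is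
-- absolutely continuous with respect to the law of `X_0`.
theorem volume_preimage_generator {A : Set unitInterval} (hA : MeasurableSet A)
    (hA0 : volume A = 0) : volume {z | 0 ≤ z ∧ williamsonGenerator n γ z ∈ A} = 0 := by
  have hψ := (continuous_williamsonGenerator hγ (n := n)).measurable
  have : NeZero n := ⟨hn⟩
  rw [← map_generator_eval hγ hn hU 0, Measure.map_apply hψ hA] at hA0
  have := restrict_absolutelyContinuous_radialLaw_map_eval hU (0 : Fin n) hA0
  rw [Measure.restrict_apply (hψ hA)] at this
  refine measure_mono_null (fun z hz => ?_) this
  exact ⟨hz.2, hz.1⟩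

include hγ hn hU in
-- A continuous injection of `ℝ≥0` is a measurable embedding, so its inverse extends measurably from
-- the range.
theorem exists_measurable_leftInverse : ∃ φ : unitInterval → ℝ, Measurable φ ∧
    ∀ z, 0 ≤ z → φ (williamsonGenerator n γ z) = z := by
  have hg := isGenerator_williamsonGenerator hγ hn hU
  have hinj : Function.Injective fun z : ℝ≥0 => williamsonGenerator n γ z := fun z z' h =>
    NNReal.coe_injective ((williamsonGenerator_strictAntiOn hγ hn hU).injOn z.2 z'.2 h)
  obtain ⟨φ, hφ, hφ'⟩ := (hg.continuous.measurableEmbedding hinj).exists_measurable_extend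
    measurable_coe_nnreal_real fun _ => ⟨0⟩
  exact ⟨φ, hφ, fun z hz => congrFun hφ' ⟨z, hz⟩⟩

include hγ hn hU in
-- The opposite direction: the law of `X_0` has no mass on Lebesgue null sets, and `ψ` carries it to
-- the uniform law.
theorem volume_preimage_leftInverse {φ : unitInterval → ℝ} (hφ : Measurable φ)
    (hφ' : ∀ z, 0 ≤ z → φ (williamsonGenerator n γ z) = z) {A : Set ℝ} (hA : MeasurableSet A)
    (hA0 : volume A = 0) : volume (φ ⁻¹' A) = 0 := by
  have hψ := (continuous_williamsonGenerator hγ (n := n)).measurable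
  have : NeZero n := ⟨hn⟩
  have hm : Measurable fun p : (Fin n → ℝ) × ℝ => p.1 0 := by fun_prop
  rw [← map_generator_eval hγ hn hU 0, Measure.map_apply hψ (hφ hA),
    Measure.map_apply hm (hψ (hφ hA))]
  have h1 := radialLaw_map_eval_absolutelyContinuous (γ := γ) (0 : Fin n) hA0
  rw [Measure.map_apply hm hA] at h1
  rw [measure_eq_zero_iff_ae_notMem] at h1 ⊢
  filter_upwards [h1, ae_radialLaw_mem n γ] with p hp hp' h
  refine hp ?_
  change φ (williamsonGenerator n γ (p.1 0)) ∈ A at h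
  rwa [hφ' _ (hp'.1 0)] at h

include hγ hn hU in
-- The law of `X` is dominated by Lebesgue measure on the orthant, hence by the product of `n`
-- copies of the law of `X_0`, which `ψ` carries coordinatewise to Lebesgue measure on the cube.
theorem map_fst_absolutelyContinuous :
    (volume.withDensity (radialDensity n γ)).map (fun x i => williamsonGenerator n γ (x i))
      ≪ volume := by
  have hψ := (continuous_williamsonGenerator hγ (n := n)).measurable
  have : NeZero n := ⟨hn⟩
  set μ₁ := (radialLaw n γ).map (fun p : (Fin n → ℝ) × ℝ => p.1 0) with hμ₁
  have := isProbabilityMeasure_radialLaw hn hγ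
  have : IsProbabilityMeasure μ₁ := Measure.isProbabilityMeasure_map (by fun_prop)
  have h1 : volume.withDensity (radialDensity n γ)
      ≪ Measure.pi fun _ : Fin n => volume.restrict (Set.Ici (0 : ℝ)) := by
    rw [← Measure.restrict_pi_pi, ← volume_pi]
    refine Measure.AbsolutelyContinuous.mk fun A hA hA0 => ?_
    rw [withDensity_apply _ hA]
    rw [Measure.restrict_apply hA] at hA0
    refine lintegral_eq_zero_of_ae_eq_zero ?_
    rw [EventuallyEq, ae_restrict_iff' hA]
    filter_upwards [measure_eq_zero_iff_ae_notMem.1 hA0] with x hx hxA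
    refine lintegral_eq_zero_of_ae_eq_zero (ae_of_all _ fun r => ?_)
    exact simplexDensity_of_notMem fun h => hx ⟨hxA, fun i _ => h.1 i⟩
  have h2 := h1.trans (pi_absolutelyContinuous _ _
    (restrict_absolutelyContinuous_radialLaw_map_eval hU (0 : Fin n)))
  have h3 := h2.map (f := fun x i => williamsonGenerator n γ (x i)) (by fun_prop)
  refine h3.trans ?_
  have h4 := Measure.pi_map_pi (μ := fun _ : Fin n => μ₁)
    (f := fun _ => williamsonGenerator n γ) (hμ := fun _ => by
      rw [map_generator_eval hγ hn hU]; infer_instance) (fun _ => hψ.aemeasurable)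
  rw [h4, map_generator_eval hγ hn hU, volume_pi]

end generator

/-! ### The Markov kernel of a copula with a given Williamson measure -/

theorem measurable_pi_comp {n : ℕ} {φ : unitInterval → ℝ} (hφ : Measurable φ) :
    Measurable fun (u : Cube n) i => φ (u i) := by fun_prop

/-- The part of the Markov kernel that stems from the part `g` of the Williamson measure `γ`; here
`φ` is a left inverse of the generator `ψ`. -/
noncomputable def cubeKernel (n : ℕ) (γ g : Measure ℝ) [SFinite g] {φ : unitInterval → ℝ}
    (hφ : Measurable φ) (ψ : ℝ → unitInterval) : Kernel (Cube n) unitInterval :=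
  -- The identity factor keeps `u` available, so that the `u`-dependent translation is a map by one
  -- jointly measurable function.
  (Kernel.id ×ₖ (radialKernel n γ g).comap (fun u i => φ (u i)) (measurable_pi_comp hφ)).map
    fun q => ψ (q.2 - ∑ i, φ (q.1 i))

section cubeKernel

variable {n : ℕ} {γ g : Measure ℝ} [IsFiniteMeasure γ] [SFinite g] {φ : unitInterval → ℝ}
  (hφ : Measurable φ) {ψ : ℝ → unitInterval} (hψ : Measurable ψ) (hg : g ≤ γ)

include hψ hg in
theorem cubeKernel_apply (u : Cube n) : cubeKernel n γ g hφ ψ u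
    = (radialKernel n γ g fun i => φ (u i)).map fun r => ψ (r - ∑ i, φ (u i)) := by
  have := isFiniteKernel_radialKernel (n := n) hg
  have hm : Measurable fun q : Cube n × ℝ => ψ (q.2 - ∑ i, φ (q.1 i)) := by fun_prop
  rw [cubeKernel, Kernel.map_apply _ hm, Kernel.prod_apply, Kernel.id_apply, Kernel.comap_apply,
    Measure.dirac_prod, Measure.map_map hm measurable_prodMk_left]
  rfl

include hg in
theorem isFiniteKernel_cubeKernel : IsFiniteKernel (cubeKernel n γ g hφ ψ) := by
  have := isFiniteKernel_radialKernel (n := n) hg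
  unfold cubeKernel
  infer_instance

include hψ in
theorem cubeKernel_add {g' : Measure ℝ} [SFinite g'] (hg : g + g' ≤ γ) :
    cubeKernel n γ (g + g') hφ ψ = cubeKernel n γ g hφ ψ + cubeKernel n γ g' hφ ψ := by
  ext1 u
  have hm : Measurable fun r => ψ (r - ∑ i, φ (u i)) := by fun_prop
  rw [add_apply, cubeKernel_apply hφ hψ hg,
    cubeKernel_apply hφ hψ ((Measure.le_add_right le_rfl).trans hg),
    cubeKernel_apply hφ hψ ((Measure.le_add_left le_rfl).trans hg), radialKernel_apply,
    radialKernel_apply, radialKernel_apply, withDensity_add_measure, Measure.map_add _ _ hm]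

include hψ in
theorem map_compProd_cubeKernel (hn : n ≠ 0) (hγ : ∀ᵐ r ∂γ, 0 < r) (hg : g ≤ γ)
    (hφψ : ∀ z, 0 ≤ z → φ (ψ z) = z) :
    (volume.withDensity (radialDensity n γ)).map (fun x i => ψ (x i)) ⊗ₘ cubeKernel n γ g hφ ψ
      = (radialLaw n g).map fun p => ((fun i => ψ (p.1 i)), ψ (p.2 - ∑ i, p.1 i)) := by
  have hk := isFiniteKernel_radialKernel (n := n) hg
  have hK := isFiniteKernel_cubeKernel (n := n) hφ (ψ := ψ) hg
  have hm1 : Measurable fun (x : Fin n → ℝ) i => ψ (x i) := by fun_prop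
  have hm2 : Measurable fun p : (Fin n → ℝ) × ℝ =>
    ((fun i => ψ (p.1 i)), ψ (p.2 - ∑ i, p.1 i)) := by fun_prop
  ext s hs
  rw [Measure.compProd_apply hs, lintegral_map (Kernel.measurable_kernel_prodMk_left hs) hm1,
    Measure.map_apply hm2 hs, radialLaw_eq_compProd hn hγ hg, Measure.compProd_apply (hm2 hs)]
  refine lintegral_congr_ae ?_
  have hae : ∀ᵐ x ∂volume.withDensity (radialDensity n γ), ∀ i, 0 ≤ x i := by
    rw [ae_withDensity_iff (measurable_radialDensity n γ)]
    refine ae_of_all _ fun x hx => ?_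
    by_contra h
    refine hx (lintegral_eq_zero_of_ae_eq_zero (ae_of_all _ fun r => ?_))
    exact simplexDensity_of_notMem fun hx => h hx.1
  filter_upwards [hae] with x hx
  have hm : Measurable fun r => ψ (r - ∑ i, x i) := by fun_prop
  rw [cubeKernel_apply hφ hψ hg]
  simp only [hφψ _ (hx _)]
  rw [Measure.map_apply hm (measurable_prodMk_left hs)]
  rfl

end cubeKernel

section components

variable {γ : Measure ℝ} [IsProbabilityMeasure γ] (hγ : ∀ᵐ r ∂γ, 0 < r) {n : ℕ} (hn : n ≠ 0)
  (hU : ChargesPositive γ) {g : Measure ℝ} [SFinite g] (hg : g ≤ γ)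
  {φ : unitInterval → ℝ} (hφ : Measurable φ)
  (hφψ : ∀ z, 0 ≤ z → φ (williamsonGenerator n γ z) = z)

include hγ hn hU hg in
-- Almost surely `r - c ≥ 0`, where `ψ` pulls null sets back to null sets; translation by `c`
-- preserves them.
theorem cubeKernel_absolutelyContinuous (hgv : g ≪ volume) (u : Cube n) :
    cubeKernel n γ g hφ (williamsonGenerator n γ) u ≪ volume := by
  have hψ := (continuous_williamsonGenerator hγ (n := n)).measurable
  set c := ∑ i, φ (u i) with hc
  have hm : Measurable fun r => williamsonGenerator n γ (r - c) := by fun_prop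
  rw [cubeKernel_apply hφ hψ hg]
  refine Measure.AbsolutelyContinuous.mk fun A hA hA0 => ?_
  rw [Measure.map_apply hm hA]
  have h1 := volume_preimage_generator hγ hn hU hA hA0
  have h2 : volume {r | 0 ≤ r - c ∧ williamsonGenerator n γ (r - c) ∈ A} = 0 := by
    rw [← (measurePreserving_sub_right volume c).measure_preimage
      (NullMeasurableSet.of_null h1)] at h1
    exact h1
  have h3 := (radialKernel_absolutelyContinuous (γ := γ) fun i => φ (u i)) (hgv h2)
  rw [measure_eq_zero_iff_ae_notMem] at h3 ⊢
  filter_upwards [h3, ae_radialKernel_le (γ := γ) (g := g) fun i => φ (u i)] with r hr hr' h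
  exact hr ⟨sub_nonneg.2 hr', h⟩

include hγ hg in
theorem exists_countable_cubeKernel (hgD : ∃ D : Set ℝ, D.Countable ∧ g Dᶜ = 0) (u : Cube n) :
    ∃ D : Set unitInterval, D.Countable ∧
      cubeKernel n γ g hφ (williamsonGenerator n γ) u Dᶜ = 0 := by
  have hψ := (continuous_williamsonGenerator hγ (n := n)).measurable
  obtain ⟨D, hD, hD0⟩ := hgD
  have hc := hD.image fun r => williamsonGenerator n γ (r - ∑ i, φ (u i))
  have hm : Measurable fun r => williamsonGenerator n γ (r - ∑ i, φ (u i)) := by fun_prop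
  refine ⟨_, hc, ?_⟩
  rw [cubeKernel_apply hφ hψ hg, Measure.map_apply hm hc.measurableSet.compl]
  refine measure_mono_null (fun r hr => ?_)
    ((radialKernel_absolutelyContinuous (γ := γ) fun i => φ (u i)) hD0)
  exact fun h => hr (Set.mem_image_of_mem _ h)

include hγ hn hU hg hφψ in
-- The carrier is the preimage under `φ` of `N` translated by `-c`; here the null-set property of
-- `φ` is used.
theorem exists_null_cubeKernel
    (hgN : ∃ N : Set ℝ, MeasurableSet N ∧ volume N = 0 ∧ g Nᶜ = 0) (u : Cube n) :
    ∃ N : Set unitInterval, MeasurableSet N ∧ volume N = 0 ∧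
      cubeKernel n γ g hφ (williamsonGenerator n γ) u Nᶜ = 0 := by
  have hψ := (continuous_williamsonGenerator hγ (n := n)).measurable
  obtain ⟨N, hN, hN0, hgN⟩ := hgN
  set c := ∑ i, φ (u i) with hc
  have hm : Measurable fun r => williamsonGenerator n γ (r - c) := by fun_prop
  have hA : MeasurableSet ((fun z => z + c) ⁻¹' N) := (measurable_add_const c) hN
  have hA0 : volume ((fun z => z + c) ⁻¹' N) = 0 := by
    rw [measure_preimage_add_right, hN0]
  refine ⟨_, hφ hA, volume_preimage_leftInverse hγ hn hU hφ hφψ hA hA0, ?_⟩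
  rw [cubeKernel_apply hφ hψ hg, Measure.map_apply hm (hφ hA).compl]
  have h3 := (radialKernel_absolutelyContinuous (γ := γ) fun i => φ (u i)) hgN
  rw [measure_eq_zero_iff_ae_notMem] at h3 ⊢
  filter_upwards [h3, ae_radialKernel_le (γ := γ) (g := g) fun i => φ (u i)] with r hr hr' h
  refine hr fun hrN => h ?_
  change φ (williamsonGenerator n γ (r - c)) + c ∈ N
  rwa [hφψ _ (sub_nonneg.2 hr'), sub_add_cancel]

include hγ hn hU hg in
theorem cubeKernel_singleton (hg0 : ∀ x, g {x} = 0) (u : Cube n) (v : unitInterval) :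
    cubeKernel n γ g hφ (williamsonGenerator n γ) u {v} = 0 := by
  have hψ := (continuous_williamsonGenerator hγ (n := n)).measurable
  have hm : Measurable fun r => williamsonGenerator n γ (r - ∑ i, φ (u i)) := by fun_prop
  rw [cubeKernel_apply hφ hψ hg, Measure.map_apply hm (measurableSet_singleton v)]
  have hle := ae_radialKernel_le (n := n) (γ := γ) (g := g) fun i => φ (u i)
  have hsub : {r | ∑ i, φ (u i) ≤ r ∧ williamsonGenerator n γ (r - ∑ i, φ (u i)) = v}.Subsingleton := by
    rintro r ⟨hr, hrv⟩ r' ⟨hr', hrv'⟩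
    have := (williamsonGenerator_strictAntiOn hγ hn hU).injOn
      (sub_nonneg.2 hr) (sub_nonneg.2 hr') (hrv.trans hrv'.symm)
    linarith
  have hnull : NullSingletonClass g := ⟨hg0⟩
  have h3 := (radialKernel_absolutelyContinuous (γ := γ) fun i => φ (u i))
    (hsub.measure_zero g)
  rw [measure_eq_zero_iff_ae_notMem] at h3 ⊢
  filter_upwards [h3, hle] with r hr hr' h
  exact hr ⟨hr', h⟩

end components

/-- The conditional law of the last coordinate splits along `γa + γd + γs`, and each summand
inherits the Lebesgue type of its part, so `Copula.components_eq` applies. -/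
theorem components_of_lebesgueParts {n : ℕ} (hn : n ≠ 0) {γa γd γs : Measure ℝ}
    (hparts : LebesgueParts γa γd γs) (hprob : IsProbabilityMeasure (γa + γd + γs))
    (hγ : ∀ᵐ r ∂(γa + γd + γs), 0 < r) (hU : ChargesPositive (γa + γd + γs)) {C : Copula (n + 1)}
    (hC : C.measure = (radialLaw n (γa + γd + γs)).map
      (radialMap n (williamsonGenerator n (γa + γd + γs)))) :
    C.marginal ≪ volume ∧
    C.absComponent = (radialLaw n γa).map (radialMap n (williamsonGenerator n (γa + γd + γs))) ∧
    C.disComponent = (radialLaw n γd).map (radialMap n (williamsonGenerator n (γa + γd + γs))) ∧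
    C.singComponent = (radialLaw n γs).map
      (radialMap n (williamsonGenerator n (γa + γd + γs))) := by
  set γ := γa + γd + γs with hγdef
  have hga : γa ≤ γ := by rw [hγdef, add_assoc]; exact Measure.le_add_right le_rfl
  have hgad : γa + γd ≤ γ := Measure.le_add_right le_rfl
  have hgd : γd ≤ γ := (Measure.le_add_left le_rfl).trans hgad
  have hgs : γs ≤ γ := Measure.le_add_left le_rfl
  have := isFiniteMeasure_of_le γ hga
  have := isFiniteMeasure_of_le γ hgd
  have := isFiniteMeasure_of_le γ hgs
  have hψc := continuous_williamsonGenerator hγ (n := n)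
  set ψ := williamsonGenerator n γ with hψdef
  have hψ := hψc.measurable
  have hrm : Measurable (radialMap n ψ) := (continuous_radialMap hψc).measurable
  obtain ⟨φ, hφ, hφψ⟩ := exists_measurable_leftInverse hγ hn hU
  have hmarg : C.marginal = (volume.withDensity (radialDensity n γ)).map fun x i => ψ (x i) := by
    rw [Copula.marginal, hC, ← radialLaw_map_fst, Measure.map_map measurable_firstCoords hrm,
      Measure.map_map (by fun_prop) measurable_fst]
    congr 1
    funext p
    exact firstCoords_radialMap ψ p
  have hka := isFiniteKernel_cubeKernel (n := n) hφ (ψ := ψ) hga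
  have hkd := isFiniteKernel_cubeKernel (n := n) hφ (ψ := ψ) hgd
  have hks := isFiniteKernel_cubeKernel (n := n) hφ (ψ := ψ) hgs
  have hKadd : cubeKernel n γ γa hφ ψ + cubeKernel n γ γd hφ ψ + cubeKernel n γ γs hφ ψ
      = cubeKernel n γ γ hφ ψ := by
    rw [← cubeKernel_add hφ hψ hgad, ← cubeKernel_add hφ hψ le_rfl]
  have hjoint : C.measure.map (fun u => (firstCoords u, lastCoord u)) = C.marginal ⊗ₘ
      (cubeKernel n γ γa hφ ψ + cubeKernel n γ γd hφ ψ + cubeKernel n γ γs hφ ψ) := by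
    rw [hKadd, hmarg, map_compProd_cubeKernel hφ hψ hn hγ le_rfl hφψ, hC,
      Measure.map_map (measurable_firstCoords.prodMk measurable_lastCoord) hrm]
    congr 1
    funext p
    simp only [Function.comp, firstCoords_radialMap, lastCoord_radialMap]
  have hcomp := C.components_eq hjoint
    (cubeKernel_absolutelyContinuous hγ hn hU hga hφ hparts.absolutelyContinuous)
    (exists_countable_cubeKernel hγ hgd hφ hparts.countable)
    (exists_null_cubeKernel hγ hn hU hgs hφ hφψ hparts.null)
    (cubeKernel_singleton hγ hn hU hgs hφ hparts.singleton)
  have himage : ∀ (g : Measure ℝ) [SFinite g], g ≤ γ →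
      (C.marginal ⊗ₘ cubeKernel n γ g hφ ψ).map joinCoords = (radialLaw n g).map (radialMap n ψ) := by
    intro g _ hg
    rw [hmarg, map_compProd_cubeKernel hφ hψ hn hγ hg hφψ,
      Measure.map_map measurable_joinCoords (by fun_prop)]
    rfl
  rw [himage γa hga, himage γd hgd, himage γs hgs] at hcomp
  refine ⟨?_, hcomp⟩
  rw [hmarg]
  exact map_fst_absolutelyContinuous hγ hn hU

/-! ### Supports -/

theorem dense_openCube (d : ℕ) : Dense {u : Cube d | ∀ i, u i ∈ Set.Ioo 0 1} := by
  have h : Dense (Set.Ioo (0 : unitInterval) 1) := by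
    rw [dense_iff_closure_eq, closure_Ioo zero_ne_one]
    exact Set.eq_univ_of_forall fun v => ⟨unitInterval.nonneg', unitInterval.le_one'⟩
  have := dense_pi (Set.univ : Set (Fin d)) (s := fun _ => Set.Ioo (0 : unitInterval) 1)
    fun _ _ => h
  exact this.mono fun u hu i => Set.mem_univ_pi.1 hu i

/-- Every nonempty open set meets the open cube, whose points come from pairs `(x, r)` with `x > 0`
and `∑ x_i < r`. Around such a pair the simplex density is nonzero and both Lebesgue measure and `g`
charge neighbourhoods. -/
theorem support_map_radialMap {γ : Measure ℝ} [IsProbabilityMeasure γ] (hγ : ∀ᵐ r ∂γ, 0 < r)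
    {n : ℕ} (hn : n ≠ 0) (hU : ChargesPositive γ) {g : Measure ℝ} [SFinite g]
    (hg : ChargesPositive g) :
    ((radialLaw n g).map (radialMap n (williamsonGenerator n γ))).support = Set.univ := by
  have hψ := continuous_radialMap (n := n) (continuous_williamsonGenerator hγ (n := n))
  have hgen := isGenerator_williamsonGenerator hγ hn hU
  refine Set.eq_univ_of_forall fun u => (Measure.mem_support_iff_forall u).2 fun O hO => ?_
  obtain ⟨O', hO'O, hO', huO'⟩ := mem_nhds_iff.1 hO
  refine lt_of_lt_of_le ?_ (measure_mono hO'O)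
  rw [Measure.map_apply hψ.measurable hO'.measurableSet]
  obtain ⟨v, hv, hvO⟩ := (dense_openCube (n + 1)).exists_mem_open hO' ⟨u, huO'⟩
  choose a ha using fun i => hgen.exists_eq (hv i).1
  have ha0 : ∀ i, (0 : ℝ) < a i := by
    intro i
    rw [NNReal.coe_pos, pos_iff_ne_zero]
    intro h0
    have h1 := ha i
    rw [h0, hgen.map_zero] at h1
    exact (hv i).2.ne h1.symm
  set x₀ : Fin n → ℝ := fun i => a i.castSucc with hx₀
  set r₀ : ℝ := ∑ i, x₀ i + a (Fin.last n) with hr₀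
  have hmem : radialMap n (williamsonGenerator n γ) (x₀, r₀) ∈ O' := by
    have : radialMap n (williamsonGenerator n γ) (x₀, r₀) = v := by
      funext i
      refine Fin.lastCases ?_ (fun j => ?_) i
      · rw [radialMap_last, ← ha]
        simp [hr₀]
      · rw [radialMap_castSucc, ← ha]
    rwa [this]
  have hW : IsOpen {p : (Fin n → ℝ) × ℝ | (∀ i, 0 < p.1 i) ∧ ∑ i, p.1 i < p.2} := by
    have : {p : (Fin n → ℝ) × ℝ | (∀ i, 0 < p.1 i) ∧ ∑ i, p.1 i < p.2}
        = (⋂ i, {p | 0 < p.1 i}) ∩ {p | ∑ i, p.1 i < p.2} := by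
      ext p; simp
    rw [this]
    exact (isOpen_iInter_of_finite fun i => isOpen_lt (by fun_prop) (by fun_prop)).inter
      (isOpen_lt (by fun_prop) (by fun_prop))
  obtain ⟨A, B, hA, hB, hxA, hrB, hAB⟩ := isOpen_prod_iff.1 ((hO'.preimage hψ).inter hW) x₀ r₀
    ⟨hmem, fun i => ha0 _, by simp only [hr₀]; linarith [ha0 (Fin.last n)]⟩
  refine (radialLaw_pos (s := A ×ˢ B) (fun p hp => ?_) ?_).trans_le
    (measure_mono fun p hp => (hAB hp).1)
  · have := (hAB hp).2
    exact ⟨fun i => (this.1 i).le, this.2.le⟩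
  · rw [Measure.prod_prod]
    refine ENNReal.mul_pos (hA.measure_pos _ ⟨x₀, hxA⟩).ne' (hg B hB ⟨r₀, hrB, ?_⟩).ne'
    have : 0 ≤ ∑ i, x₀ i := Finset.sum_nonneg fun i _ => (ha0 _).le
    simp only [Set.mem_Ioi, hr₀]
    linarith [ha0 (Fin.last n)]

/-! ### Density of Archimedean copulas with prescribed components -/

theorem exists_archimedean_near {n : ℕ} (hn : n ≠ 0) (A : ArchimedeanCopula (n + 1)) {ε : ℝ}
    (hε : 0 < ε) {ca cd cs : ℝ≥0} (hc : ca + cd + cs = 1) :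
    ∃ C : ArchimedeanCopula (n + 1), dist A C < ε ∧ C.1.marginal ≪ volume ∧
      C.1.measure.support = Set.univ ∧
      (C.1.absComponent Set.univ = ca ∧ C.1.disComponent Set.univ = cd ∧
        C.1.singComponent Set.univ = cs) ∧
      (ca ≠ 0 → C.1.absComponent.support = Set.univ) ∧
      (cd ≠ 0 → C.1.disComponent.support = Set.univ) ∧
      (cs ≠ 0 → C.1.singComponent.support = Set.univ) := by
  obtain ⟨A, ψ, hψ, hA⟩ := A
  -- `dist_copula_le` loses the factor `d + 1 = n + 2`, and the extra `2` makes the bound strict.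
  -- Half of `δ` is spent on the discrete approximation, half on the perturbation.
  set δ : ℝ := ε / (2 * (n + 2)) with hδdef
  have hδ : 0 < δ := by positivity
  obtain ⟨α, hαp, hα, hαD, hαψ⟩ := hψ.exists_williamson_near hn hA (half_pos hδ)
  obtain ⟨γa, γd, γs, hparts, hprob, hγ, ⟨ma, md, ms⟩, ua, ud, us, hnear⟩ :=
    exists_lebesgueParts_near hα hαD n (half_pos hδ) hc
  set γ := γa + γd + γs with hγdef
  have hga : γa ≤ γ := by rw [hγdef, add_assoc]; exact Measure.le_add_right le_rfl
  have hgd : γd ≤ γ := (Measure.le_add_left le_rfl).trans (Measure.le_add_right le_rfl)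
  have hgs : γs ≤ γ := Measure.le_add_left le_rfl
  have := isFiniteMeasure_of_le γ hga
  have := isFiniteMeasure_of_le γ hgd
  have := isFiniteMeasure_of_le γ hgs
  -- The weights sum to `1`, so one of them is nonzero, and that part already charges every
  -- interval.
  have hU : ChargesPositive γ := by
    by_cases h1 : ca = 0
    · by_cases h2 : cd = 0
      · refine (us ?_).mono hgs
        rintro rfl
        simp [h1, h2] at hc
      · exact (ud h2).mono hgd
    · exact (ua h1).mono hga
  obtain ⟨C, hCm, hC⟩ := exists_archimedean_of_williamson hγ hn hU
  have hgen := isGenerator_williamsonGenerator hγ hn hU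
  obtain ⟨hmarg, e1, e2, e3⟩ := components_of_lebesgueParts hn hparts hprob hγ hU hCm
  have hrm := (continuous_radialMap (n := n) (continuous_williamsonGenerator hγ (n := n))).measurable
  have mass : ∀ (g : Measure ℝ) [SFinite g], g ≤ γ →
      (radialLaw n g).map (radialMap n (williamsonGenerator n γ)) Set.univ = g Set.univ := by
    intro g _ hg
    rw [Measure.map_apply hrm MeasurableSet.univ, Set.preimage_univ,
      radialLaw_univ hn ((Measure.absolutelyContinuous_of_le hg).ae_le hγ)]
  refine ⟨⟨C, _, hgen, hC⟩, ?_, hmarg, ?_, ⟨?_, ?_, ?_⟩, fun h => ?_, fun h => ?_, fun h => ?_⟩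
  · have h1 : dist A C ≤ ((n + 1 : ℕ) + 1) * δ := by
      refine dist_copula_le hψ hgen hA hC fun z => ?_
      have b1 := hαψ z
      have b2 := hnear z z.2
      rw [coe_williamsonGenerator hγ (NNReal.coe_nonneg z)]
      rw [abs_le] at *
      constructor <;> linarith
    have h2 : (((n + 1 : ℕ) : ℝ) + 1) * δ = ε / 2 := by
      rw [hδdef]; push_cast; field_simp; ring
    have h3 : dist A C < ε := by linarith
    exact h3
  · exact hCm ▸ support_map_radialMap hγ hn hU hU
  · exact (e1 ▸ mass γa hga).trans ma
  · exact (e2 ▸ mass γd hgd).trans md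
  · exact (e3 ▸ mass γs hgs).trans ms
  · exact e1 ▸ support_map_radialMap hγ hn hU (ua h)
  · exact e2 ▸ support_map_radialMap hγ hn hU (ud h)
  · exact e3 ▸ support_map_radialMap hγ hn hU (us h)

end Archimedean

/-! ### The four dense families, by choice of weights -/

theorem theorem3p12 (n : ℕ) (hn : 1 ≤ n) :
    Dense {C : Archimedean.ArchimedeanCopula (n + 1) |
      C.1.IsAbsolutelyContinuous ∧ C.1.measure.support = Set.univ} ∧
    Dense {C : Archimedean.ArchimedeanCopula (n + 1) |
      C.1.IsDiscrete ∧ C.1.measure.support = Set.univ} ∧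
    Dense {C : Archimedean.ArchimedeanCopula (n + 1) |
      C.1.IsSingular ∧ C.1.measure.support = Set.univ} ∧
    Dense {C : Archimedean.ArchimedeanCopula (n + 1) |
      C.1.absComponent.support = Set.univ ∧ C.1.disComponent.support = Set.univ ∧
        C.1.singComponent.support = Set.univ} := by
  have hn' : n ≠ 0 := by omega
  refine ⟨?_, ?_, ?_, ?_⟩ <;> refine Metric.dense_iff.2 fun A ε hε => ?_
  · obtain ⟨C, hd, hm, hs, ⟨h, -⟩, -⟩ := Archimedean.exists_archimedean_near hn' A hε
      (ca := 1) (cd := 0) (cs := 0) (by norm_num)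
    exact ⟨C, Metric.mem_ball'.2 hd, ⟨hm, by simpa using h⟩, hs⟩
  · obtain ⟨C, hd, hm, hs, ⟨-, h, -⟩, -⟩ := Archimedean.exists_archimedean_near hn' A hε
      (ca := 0) (cd := 1) (cs := 0) (by norm_num)
    exact ⟨C, Metric.mem_ball'.2 hd, ⟨hm, by simpa using h⟩, hs⟩
  · obtain ⟨C, hd, hm, hs, ⟨-, -, h⟩, -⟩ := Archimedean.exists_archimedean_near hn' A hε
      (ca := 0) (cd := 0) (cs := 1) (by norm_num)
    exact ⟨C, Metric.mem_ball'.2 hd, ⟨hm, by simpa using h⟩, hs⟩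
  -- Any three positive weights with sum `1` would serve.
  · obtain ⟨C, hd, -, -, -, h1, h2, h3⟩ := Archimedean.exists_archimedean_near hn' A hε
      (ca := 1 / 3) (cd := 1 / 3) (cs := 1 / 3) (by rw [← NNReal.coe_inj]; push_cast; norm_num)
    exact ⟨C, Metric.mem_ball'.2 hd, h1 (by norm_num), h2 (by norm_num), h3 (by norm_num)⟩
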